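/- Let $\chi=\mathbf 1_{(0,1]}$ and let $\{x\}=x-\lfloor x\rfloor$ denote the fractional part. For every $\nu>0$ there is a constant $C=C(\nu)>0$, depending only on $\nu$, with the following property. Let $(\Omega,\mathcal F,\mathbb P)$ be a probability space and let $(Z_{k,n})_{n\ge 1,\,1\le k\le n}$ be a family of square integrable, almost surely nonnegative random variables on it which satisfies Assumption $(\mathcal P)$ with the constant $\nu$, that is, $$\mathbb P\Big(\bigcap_{1\le k\le n}\{0<Z_{k,n}\le 1\}\Big)>\nu\qquad\text{for all } n\ge 1 .$$ For $n\ge1$ put $m_n=\min_{1\le k\le n}Z_{k,n}$ and $$\mathcal D_n=\inf_{c_1,\dots,c_n\in\mathbb R}\left(\mathbb E\int_0^\infty\Big(\chi(t)-\sum_{k=1}^n c_k\Big\{\frac{Z_{k,n}}{t}\Big\}\Big)^2dt\right)^{1/2}.$$ Then, for all $n\ge 1$, $$\mathcal D_n^2\ \ge\ \frac{C}{\log 2+\mathbb E|\log m_n|},$$ where $|\log 0|=\infty$ and the right-hand side is $0$ if $\mathbb E|\log m_n|=\infty$. -/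

import Mathlib

open MeasureTheory Set
open scoped ENNReal

universe u

noncomputable section

namespace PNB

/-- The target function `χ`, the indicator function of `(0, 1]`. -/
def chi (t : ℝ) : ℝ := (Ioc (0 : ℝ) 1).indicator 1 t

/-- `X ∈ L²₊(Ω)`: `X` is a square integrable random variable that is almost surely nonnegative. -/
def MemL2Plus {Ω : Type*} [MeasurableSpace Ω] (P : Measure Ω) (X : Ω → ℝ) : Prop :=
  MemLp X 2 P ∧ 0 ≤ᵐ[P] X

/-- The norm of `ℋ = L²(Ω, L²(0,∞))`, that is `(𝔼 ∫₀^∞ F(ω,t)² dt)^(1/2)`, with values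
in `[0, ∞]`. -/
def hNorm {Ω : Type*} [MeasurableSpace Ω] (P : Measure Ω) (F : Ω → ℝ → ℝ) : ℝ≥0∞ :=
  (∫⁻ ω, (∫⁻ t in Ioi (0 : ℝ), ENNReal.ofReal (F ω t ^ 2)) ∂P) ^ (1 / 2 : ℝ)

/-- The triangular family satisfies Assumption `(𝒫)` with the constant `ν`: for all `n ≥ 1`, the
event `Bₙ = ⋂ₖ {0 < Z_{k,n} ≤ 1}` has probability greater than `ν > 0`.
Here `Z n k` stands for `Z_{k+1,n}`, `k = 0, …, n - 1`. -/
def AssumptionP {Ω : Type*} [MeasurableSpace Ω] (P : Measure Ω)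
    (Z : (n : ℕ) → Fin n → Ω → ℝ) (ν : ℝ) : Prop :=
  0 < ν ∧ ∀ n : ℕ, 1 ≤ n → ENNReal.ofReal ν < P (⋂ k : Fin n, {ω | 0 < Z n k ω ∧ Z n k ω ≤ 1})

/-- The distance `𝒟ₙ` in `ℋ` between `χ` and the linear combinations (with deterministic real
coefficients) of the functions `t ↦ {Z_{k,n} / t}`, `1 ≤ k ≤ n`. -/
def pNBDist {Ω : Type*} [MeasurableSpace Ω] (P : Measure Ω)
    (Z : (n : ℕ) → Fin n → Ω → ℝ) (n : ℕ) : ℝ≥0∞ :=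
  ⨅ c : Fin n → ℝ, hNorm P (fun ω t => chi t - ∑ k : Fin n, c k * Int.fract (Z n k ω / t))

/-- `mₙ = min_{1 ≤ k ≤ n} Z_{k,n}` (meant for `n ≥ 1`, where this infimum is a minimum). -/
def minZ {Ω : Type*} (Z : (n : ℕ) → Fin n → Ω → ℝ) (n : ℕ) (ω : Ω) : ℝ :=
  ⨅ k : Fin n, Z n k ω

/-- `|log x| ∈ [0, ∞]` for a real number `x ≥ 0`, with `|log 0| = ∞`. -/
def absLog (x : ℝ) : ℝ≥0∞ := (ENNReal.log (ENNReal.ofReal x)).abs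

end PNB

end

/-! The heart is a deterministic bound: if `l ≤ θ k ≤ 1` for all `k`, the squared `L²` distance from
`χ` to the span of the functions `{θ k / t}` is at least a constant over `log 2 + log (1 / l)`
(`exists_le_lintegral_chi_sub_sum_fract`). Its constant is independent of `n`, of the `θ k` and of
the coefficients, so it applies at each `ω` of the good event with `l = mₙ(ω)`. Cauchy–Schwarz on
that event, of probability greater than `ν`, then bounds the integral of the reciprocal of `log 2 +
|log mₙ|` below by `ν²` over `log 2 + 𝔼|log mₙ|`.

The deterministic bound is a duality argument after `y = 1 / t`: `exists_test_function` gives `G`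
orthogonal to `{θ y}` for `l ≤ θ ≤ 1`, with `∫_1^∞ G` bounded away from zero and a weighted norm
squared of order `log 2 + log (1 / l)`.

The source of `G` is a zero `s` of `ζ` with `1/2 ≤ Re s < 1`. Since `∫_0^∞ {t} t^(-s-1) dt = -ζ(s)/s
= 0`, the power `y^(-s-1)` is orthogonal to every dilate of the fractional part. It may miss the
required norm at infinity (logarithmically when `Re s = 1/2`), so it is cut off beyond `1 / l`.
Orthogonality need only survive for dilations `θ ≥ l`, and the cutoff uses a Schwartz kernel `m`
from Poisson summation, orthogonal to `{T x}` for all large `T` (`exists_kernel`). Multiplying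
`x^(-s-1)` by `∫_x^∞ m(y) y^s dy` keeps this orthogonality, since the difference from a multiple of
the pure power is an average of the dilates `m(x u)`, `u ≤ 1`.

The zero comes from Hadamard's argument: `ξ` has order below `2`, so without zeros it would be the
exponential of an affine function; the symmetry `s ↦ 1 - s` would make it constant, contradicting
`ζ(2) = π²/6`. -/

/-! ### Zero-free entire functions of order below two -/

/-- A zero-free entire function has an entire logarithm. -/
theorem exists_entire_log {f : ℂ → ℂ} (hf : Differentiable ℂ f) (h0 : ∀ z, f z ≠ 0) :
    ∃ g : ℂ → ℂ, Differentiable ℂ g ∧ ∀ z, f z = Complex.exp (g z) := by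
  have hd : Differentiable ℂ (fun z => deriv f z / f z) := by
    have hdf : Differentiable ℂ (deriv f) := hf.deriv
    exact hdf.div hf h0
  obtain ⟨g, hg0, hg⟩ := hd.isExactOn_univ.with_val_at 0 (Complex.log (f 0))
  have hgd : ∀ z, HasDerivAt g (deriv f z / f z) z := fun z => hg z (mem_univ z)
  refine ⟨g, fun z => (hgd z).differentiableAt, ?_⟩
  have hq : ∀ z, HasDerivAt (fun z => f z * Complex.exp (-g z)) 0 z := by
    intro z
    refine ((hf z).hasDerivAt.fun_mul ((hgd z).fun_neg.cexp)).congr_deriv ?_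
    have := h0 z
    field_simp
    ring
  intro z
  have hc := is_const_of_deriv_eq_zero (fun z => (hq z).differentiableAt) (fun z => (hq z).deriv) z 0
  simp only [hg0, Complex.exp_neg, Complex.exp_log (h0 0)] at hc
  rw [mul_inv_cancel₀ (h0 0)] at hc
  have he := Complex.exp_ne_zero (g z)
  field_simp at hc
  exact hc

/-- An entire function whose real part grows like `O(|z| ^ (3/2))` is affine. -/
theorem affine_of_re_le {g : ℂ → ℂ} (hg : Differentiable ℂ g) {A : ℝ} (hA : 0 < A)
    (hre : ∀ z, (g z).re ≤ A * (1 + ‖z‖) ^ (3 / 2 : ℝ)) :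
    ∃ a b : ℂ, ∀ z, g z = a * z + b := by
  have key : ∀ w, iteratedDeriv 2 g w = 0 := by
    intro w
    rw [← norm_le_zero_iff]
    have hbd : ∀ r : ℝ, 1 ≤ r → ‖w‖ ≤ r →
        ‖iteratedDeriv 2 g w‖ ≤ 2 * (2 * (A * (6 * r) ^ (3 / 2 : ℝ)) + 3 * ‖g 0‖) / r ^ 2 := by
      intro r hr hwr
      have hr0 : 0 < r := by linarith
      have := Complex.norm_iteratedDeriv_le_of_forall_mem_sphere_norm_le (c := w) (R := r)
        (C := 2 * (A * (6 * r) ^ (3 / 2 : ℝ)) + 3 * ‖g 0‖) (f := g) 2 hr0 hg.diffContOnCl ?_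
      · simpa using this
      · intro z hz
        have hz' : ‖z‖ ≤ 2 * r := by
          have h1 : ‖z - w‖ = r := by simpa using hz
          have := norm_add_le (z - w) w
          simp only [sub_add_cancel] at this
          linarith
        set M := A * (6 * r) ^ (3 / 2 : ℝ)
        have hM : 0 < M := by positivity
        -- Borel–Carathéodory on the disc of radius `4 r`. Since `‖z‖ ≤ 2 r`, the ratios `‖z‖ / (4r
        -- - ‖z‖)` and `(4r + ‖z‖) / (4r - ‖z‖)` are at most `1` and `3`, whence the bound `2 M + 3
        -- ‖g 0‖`.
        have hbc := Complex.borelCaratheodory (f := g) (M := M) (R := 4 * r) (z := z) hM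
          hg.differentiableOn (fun x hx => by
            have hx' : ‖x‖ < 4 * r := by simpa using hx
            refine (hre x).trans ?_
            have : 1 + ‖x‖ ≤ 6 * r := by linarith
            exact mul_le_mul_of_nonneg_left (Real.rpow_le_rpow (by positivity) this (by norm_num))
              hA.le) (by positivity) (by simp; linarith)
        refine hbc.trans (add_le_add ?_ ?_)
        · rw [div_le_iff₀ (by linarith)]
          nlinarith
        · rw [div_le_iff₀ (by linarith)]
          nlinarith [norm_nonneg (g 0)]
    have hlim : Filter.Tendsto
        (fun r : ℝ => 2 * (2 * (A * (6 * r) ^ (3 / 2 : ℝ)) + 3 * ‖g 0‖) / r ^ 2)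
        Filter.atTop (nhds 0) := by
      have h1 : Filter.Tendsto (fun r : ℝ => r ^ (-(1 / 2) : ℝ)) Filter.atTop (nhds 0) :=
        tendsto_rpow_neg_atTop (by norm_num)
      have h2 : Filter.Tendsto (fun r : ℝ => r ^ (-2 : ℝ)) Filter.atTop (nhds 0) :=
        tendsto_rpow_neg_atTop (by norm_num)
      have h3 := (h1.const_mul (4 * A * 6 ^ (3 / 2 : ℝ))).add (h2.const_mul (6 * ‖g 0‖))
      simp only [mul_zero, add_zero] at h3
      refine h3.congr' ?_
      filter_upwards [Filter.eventually_gt_atTop 0] with r hr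
      have e1 : r ^ (-(1 / 2) : ℝ) = r ^ (3 / 2 : ℝ) / r ^ 2 := by
        rw [← Real.rpow_natCast, ← Real.rpow_sub hr]; norm_num
      have e2 : r ^ (-2 : ℝ) = 1 / r ^ 2 := by
        rw [Real.rpow_neg hr.le]; norm_num
      rw [e1, e2, Real.mul_rpow (by norm_num) hr.le]
      field_simp
      ring
    exact ge_of_tendsto hlim (by
      filter_upwards [Filter.eventually_ge_atTop (max 1 ‖w‖)] with r hr
      exact hbd r ((le_max_left _ _).trans hr) ((le_max_right _ _).trans hr))
  have hd1 : Differentiable ℂ (deriv g) := hg.deriv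
  have hconst : ∀ z, deriv g z = deriv g 0 := fun z =>
    is_const_of_deriv_eq_zero hd1 (fun w => by
      have := key w
      rwa [iteratedDeriv_succ, iteratedDeriv_one] at this) z 0
  refine ⟨deriv g 0, g 0, fun z => ?_⟩
  have hq : ∀ z, HasDerivAt (fun z => g z - deriv g 0 * z) 0 z := by
    intro z
    refine ((hg z).hasDerivAt.fun_sub ((hasDerivAt_id z).const_mul (deriv g 0))).congr_deriv ?_
    simp [hconst z]
  have hc := is_const_of_deriv_eq_zero (fun z => (hq z).differentiableAt) (fun z => (hq z).deriv) z 0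
  simp only [mul_zero, sub_zero] at hc
  rw [← hc]; ring

/-- A zero-free entire function of order at most `3/2` is the exponential of an affine function. -/
theorem exp_affine_of_zero_free {f : ℂ → ℂ} (hf : Differentiable ℂ f) (h0 : ∀ z, f z ≠ 0) {A : ℝ}
    (hA : 0 < A) (hb : ∀ z, ‖f z‖ ≤ Real.exp (A * (1 + ‖z‖) ^ (3 / 2 : ℝ))) :
    ∃ a b : ℂ, ∀ z, f z = Complex.exp (a * z + b) := by
  obtain ⟨g, hg, hfg⟩ := exists_entire_log hf h0
  obtain ⟨a, b, hab⟩ := affine_of_re_le hg hA (fun z => by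
    have := hb z
    rwa [hfg, Complex.norm_exp, Real.exp_le_exp] at this)
  exact ⟨a, b, fun z => by rw [hfg, hab]⟩

/-! ### Growth of the completed zeta function -/

open HurwitzZeta in
/-- The kernel whose Mellin transform is `Λ₀` is real and nonnegative. -/
theorem hurwitzEven_f_modif_nonneg {t : ℝ} (ht : 0 < t) :
    ∃ r : ℝ, 0 ≤ r ∧ (hurwitzEvenFEPair 0).f_modif t = (r : ℂ) := by
  -- The theta series consists of positive terms, and its term of index `0` equals `1`.
  have hk : ∀ u : ℝ, 0 < u → 1 ≤ evenKernel 0 u := by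
    intro u hu
    have h := hasSum_int_evenKernel₀ 0 hu
    have h0 : (((0 : ℝ) : UnitAddCircle)) = 0 := by simp
    rw [h0, if_pos rfl] at h
    have := h.nonneg (fun n => by split_ifs <;> positivity)
    linarith
  unfold WeakFEPair.f_modif
  simp only [Pi.add_apply]
  rcases lt_trichotomy 1 t with h | rfl | h
  · refine ⟨evenKernel 0 t - 1, by linarith [hk t ht], ?_⟩
    rw [indicator_of_mem (mem_Ioi.mpr h), indicator_of_notMem (fun h' => by
      have := h'.2; linarith)]
    simp [hurwitzEvenFEPair]
  · exact ⟨0, le_rfl, by simp⟩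
  · refine ⟨evenKernel 0 t - t ^ (-(1 / 2) : ℝ), ?_, ?_⟩
    · rw [evenKernel_functional_equation, ← evenKernel_eq_cosKernel_of_zero, Real.rpow_neg ht.le,
        one_div (t ^ (1 / 2 : ℝ)), sub_nonneg]
      exact le_mul_of_one_le_right (by positivity) (hk _ (by positivity))
    · rw [indicator_of_notMem (fun h' => by have := mem_Ioi.mp h'; linarith),
        indicator_of_mem (mem_Ioo.mpr ⟨ht, h⟩)]
      simp [hurwitzEvenFEPair]

/-- The absolute moments of the kernel whose Mellin transform is `Λ₀`. -/
noncomputable def thetaMoment (σ : ℝ) : ℝ :=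
  ∫ t in Ioi (0 : ℝ), t ^ (σ / 2 - 1) * ‖(HurwitzZeta.hurwitzEvenFEPair 0).f_modif t‖

open HurwitzZeta in
theorem integrableOn_thetaMoment (σ : ℝ) :
    IntegrableOn (fun t : ℝ => t ^ (σ / 2 - 1) * ‖(hurwitzEvenFEPair 0).f_modif t‖) (Ioi 0) := by
  have h := ((WeakFEPair.isStrongFEPair_toStrongFEPair (hurwitzEvenFEPair 0)).hasMellin
    ((σ / 2 : ℝ) : ℂ)).1
  have h2 := Integrable.norm h
  refine h2.congr ?_
  filter_upwards [self_mem_ae_restrict measurableSet_Ioi] with t ht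
  rw [norm_smul, Complex.norm_cpow_eq_rpow_re_of_pos ht]
  simp [WeakFEPair.toStrongFEPair]

open HurwitzZeta in
theorem norm_completedRiemannZeta₀_le (s : ℂ) :
    ‖completedRiemannZeta₀ s‖ ≤ thetaMoment s.re / 2 := by
  change ‖(hurwitzEvenFEPair 0).Λ₀ (s / 2) / 2‖ ≤ _
  rw [norm_div, Complex.norm_two]
  gcongr
  refine (norm_integral_le_integral_norm _).trans (le_of_eq ?_)
  refine setIntegral_congr_fun measurableSet_Ioi (fun t ht => ?_)
  rw [norm_smul, Complex.norm_cpow_eq_rpow_re_of_pos ht]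
  simp

open HurwitzZeta in
-- Nonnegativity of the kernel makes the absolute moment equal to the moment itself. Bounds of `Λ₀`
-- on vertical lines thus reduce to its values on the real axis.
theorem thetaMoment_eq (σ : ℝ) : (thetaMoment σ : ℂ) = 2 * completedRiemannZeta₀ σ := by
  change _ = 2 * ((hurwitzEvenFEPair 0).Λ₀ (σ / 2) / 2)
  rw [mul_div_cancel₀ _ two_ne_zero]
  unfold thetaMoment WeakFEPair.Λ₀ mellin
  rw [← integral_complex_ofReal]
  refine setIntegral_congr_fun measurableSet_Ioi (fun t ht => ?_)
  obtain ⟨r, hr, hr'⟩ := hurwitzEven_f_modif_nonneg (mem_Ioi.mp ht)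
  simp only [hr', smul_eq_mul, Complex.norm_real, Real.norm_of_nonneg hr]
  push_cast
  rw [Complex.ofReal_cpow (mem_Ioi.mp ht).le]
  simp

/-- A power of `t` with intermediate exponent is dominated by the lower power for `t ≤ 1` and by the
upper one for `t ≥ 1`. -/
theorem thetaMoment_le {a σ b : ℝ} (h1 : a ≤ σ) (h2 : σ ≤ b) :
    thetaMoment σ ≤ thetaMoment a + thetaMoment b := by
  unfold thetaMoment
  rw [← integral_add (integrableOn_thetaMoment a) (integrableOn_thetaMoment b)]
  refine setIntegral_mono_on (integrableOn_thetaMoment σ)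
    ((integrableOn_thetaMoment a).add (integrableOn_thetaMoment b)) measurableSet_Ioi ?_
  intro t ht
  have ht : 0 < t := ht
  rw [← add_mul]
  refine mul_le_mul_of_nonneg_right ?_ (norm_nonneg _)
  rcases le_total t 1 with h | h
  · have := Real.rpow_le_rpow_of_exponent_ge ht h (show a / 2 - 1 ≤ σ / 2 - 1 by linarith)
    have h' : 0 ≤ t ^ (b / 2 - 1) := by positivity
    linarith
  · have := Real.rpow_le_rpow_of_exponent_le h (show σ / 2 - 1 ≤ b / 2 - 1 by linarith)
    have h' : 0 ≤ t ^ (a / 2 - 1) := by positivity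
    linarith

theorem norm_riemannZeta_two_mul_nat_le {N : ℕ} (hN : 1 ≤ N) : ‖riemannZeta (2 * N)‖ ≤ 2 := by
  have h := zeta_nat_eq_tsum_of_gt_one (k := 2 * N) (by omega)
  have h2 := zeta_nat_eq_tsum_of_gt_one (k := 2) (by omega)
  push_cast at h h2
  rw [h]
  have hs2 : Summable (fun n : ℕ => 1 / (n : ℝ) ^ 2) := Real.summable_one_div_nat_pow.mpr (by omega)
  have h3 : ‖∑' n : ℕ, 1 / (n : ℂ) ^ (2 * N)‖ ≤ ∑' n : ℕ, 1 / (n : ℝ) ^ 2 := by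
    refine tsum_of_norm_bounded hs2.hasSum (fun n => ?_)
    rw [norm_div, norm_pow, norm_one, Complex.norm_natCast]
    rcases Nat.eq_zero_or_pos n with rfl | hn
    · simp [show N ≠ 0 by omega]
    · have : (1 : ℝ) ≤ n := by exact_mod_cast hn
      gcongr
      omega
  refine h3.trans ?_
  rw [hasSum_zeta_two.tsum_eq]
  have := Real.pi_lt_d2
  have := Real.pi_pos
  nlinarith

/-- At `2 N` everything is explicit: the Gamma factor is `π^(-N) (N-1)!`, `ζ(2N)` is at most `2`,
and the two polar terms are at most `1` each. -/
theorem thetaMoment_two_mul_nat_le {N : ℕ} (hN : 1 ≤ N) :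
    thetaMoment (2 * N) ≤ 4 * (N.factorial : ℝ) + 4 := by
  have h := thetaMoment_eq (2 * N)
  have hN' : (1 : ℝ) ≤ N := by exact_mod_cast hN
  have hNC : (N : ℂ) ≠ 0 := by exact_mod_cast (by omega : N ≠ 0)
  have hz : completedRiemannZeta (2 * N) = Complex.Gammaℝ (2 * N) * riemannZeta (2 * N) := by
    rw [riemannZeta_def_of_ne_zero (by simpa using hNC), mul_div_cancel₀]
    apply Complex.Gammaℝ_ne_zero_of_re_pos
    simp; omega
  have heq := completedRiemannZeta_eq (2 * N)
  have hG : ‖Complex.Gammaℝ (2 * N)‖ ≤ (N.factorial : ℝ) := by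
    rw [Complex.Gammaℝ_def, norm_mul, Complex.norm_cpow_eq_rpow_re_of_pos Real.pi_pos]
    have e1 : (-(2 * (N : ℂ)) / 2).re = -N := by
      rw [neg_div, mul_div_cancel_left₀ _ two_ne_zero]; simp
    have e2 : (2 * (N : ℂ)) / 2 = ((N - 1 : ℕ) : ℂ) + 1 := by
      rw [mul_div_cancel_left₀ _ two_ne_zero]; push_cast [hN]; ring
    rw [e1, e2, Complex.Gamma_nat_eq_factorial, Complex.norm_natCast]
    have : Real.pi ^ (-(N : ℝ)) ≤ 1 := Real.rpow_le_one_of_one_le_of_nonpos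
      (by linarith [Real.pi_gt_three]) (by linarith)
    have h2 : ((N - 1).factorial : ℝ) ≤ N.factorial := by
      exact_mod_cast Nat.factorial_le (by omega)
    calc _ ≤ 1 * (N.factorial : ℝ) := by gcongr
      _ = _ := one_mul _
  have hn : thetaMoment (2 * N) ≤ ‖(thetaMoment (2 * N) : ℂ)‖ := by
    rw [Complex.norm_real]; exact le_abs_self _
  refine hn.trans ?_
  rw [h]
  push_cast
  have e : completedRiemannZeta₀ (2 * N) = Complex.Gammaℝ (2 * N) * riemannZeta (2 * N)
      + 1 / (2 * N) + 1 / (1 - 2 * N) := by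
    rw [← hz, heq]; ring
  rw [e, norm_mul, Complex.norm_two]
  have b1 : ‖(1 : ℂ) / (2 * N)‖ ≤ 1 := by
    rw [norm_div, norm_one, norm_mul, Complex.norm_two, Complex.norm_natCast]
    rw [div_le_one (by positivity)]; linarith
  have b2 : ‖(1 : ℂ) / (1 - 2 * N)‖ ≤ 1 := by
    have : (1 : ℂ) - 2 * N = ((1 - 2 * N : ℝ) : ℂ) := by push_cast; rfl
    rw [this, norm_div, norm_one, Complex.norm_real, Real.norm_eq_abs,
      abs_of_neg (by linarith), div_le_one (by linarith)]
    linarith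
  have b3 : ‖Complex.Gammaℝ (2 * N) * riemannZeta (2 * N)‖ ≤ N.factorial * 2 := by
    rw [norm_mul]
    gcongr
    exact norm_riemannZeta_two_mul_nat_le hN
  have := norm_add₃_le (a := Complex.Gammaℝ (2 * N) * riemannZeta (2 * N))
    (b := (1 : ℂ) / (2 * N)) (c := (1 : ℂ) / (1 - 2 * N))
  linarith

/-- For `Re s ≥ 1/2`, interpolate the moments between `1/2` and `2 N`; the functional equation gives
the other half-plane. -/
theorem norm_completedRiemannZeta₀_le_factorial :
    ∃ C : ℝ, 0 ≤ C ∧ ∀ (s : ℂ) (N : ℕ), 1 + ‖s‖ ≤ N →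
      ‖completedRiemannZeta₀ s‖ ≤ C + 2 * (N.factorial : ℝ) := by
  refine ⟨|thetaMoment (1 / 2)| / 2 + 2, by positivity, ?_⟩
  have main : ∀ (s : ℂ) (N : ℕ), 1 ≤ N → 1 / 2 ≤ s.re → s.re ≤ N →
      ‖completedRiemannZeta₀ s‖ ≤ |thetaMoment (1 / 2)| / 2 + 2 + 2 * (N.factorial : ℝ) := by
    intro s N hN h1 h2
    have a1 := norm_completedRiemannZeta₀_le s
    have hN' : (1 : ℝ) ≤ N := by exact_mod_cast hN
    have a2 := thetaMoment_le h1 (show s.re ≤ 2 * N by linarith)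
    have a3 := thetaMoment_two_mul_nat_le hN
    linarith [le_abs_self (thetaMoment (1 / 2))]
  intro s N hN
  have hN1 : 1 ≤ N := by
    have : (1 : ℝ) ≤ N := by linarith [norm_nonneg s]
    exact_mod_cast this
  rcases le_total (1 / 2) s.re with h | h
  · exact main s N hN1 h (by linarith [Complex.re_le_norm s])
  · rw [← completedRiemannZeta₀_one_sub]
    refine main (1 - s) N hN1 (by simp; linarith) ?_
    have := Complex.abs_re_le_norm s
    have := neg_abs_le s.re
    simp only [Complex.sub_re, Complex.one_re]
    linarith

/-! ### The `ξ` function and a zero of zeta -/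

/-- The Riemann `ξ` function, normalized by `ξ(0) = ξ(1) = 1`. -/
noncomputable def riemannXi (s : ℂ) : ℂ := 1 - s * (1 - s) * completedRiemannZeta₀ s

theorem differentiable_riemannXi : Differentiable ℂ riemannXi := by
  unfold riemannXi
  have := differentiable_completedZeta₀
  fun_prop

/-- From `N! ≤ (2r)^(2r)` and `log x ≤ 2 √x`. The exponent `3/2` simply absorbs the logarithm while
staying below `2`. -/
theorem factorial_le_exp {N : ℕ} {r : ℝ} (hr : 1 ≤ r) (hN : (N : ℝ) ≤ 2 * r) :
    (N.factorial : ℝ) ≤ Real.exp (6 * r ^ (3 / 2 : ℝ)) := by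
  have h1 : (N.factorial : ℝ) ≤ (N : ℝ) ^ N := by exact_mod_cast Nat.factorial_le_pow N
  have h2 : (N : ℝ) ^ N ≤ (2 * r) ^ N := by gcongr
  have h3 : (2 * r) ^ N ≤ (2 * r) ^ (2 * r : ℝ) := by
    rw [← Real.rpow_natCast]
    exact Real.rpow_le_rpow_of_exponent_le (by linarith) hN
  refine (h1.trans (h2.trans h3)).trans ?_
  rw [Real.rpow_def_of_pos (by linarith), Real.exp_le_exp]
  have hl := Real.log_le_rpow_div (show 0 ≤ 2 * r by linarith) (show (0 : ℝ) < 1 / 2 by norm_num)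
  have h4 : (2 * r) ^ (1 / 2 : ℝ) ≤ (3 / 2) * r ^ (1 / 2 : ℝ) := by
    rw [Real.mul_rpow (by norm_num) (by linarith)]
    gcongr
    rw [← Real.sqrt_eq_rpow, Real.sqrt_le_left (by norm_num)]
    norm_num
  have h5 : r ^ (3 / 2 : ℝ) = r * r ^ (1 / 2 : ℝ) := by
    rw [← Real.rpow_one_add' (by linarith) (by norm_num)]; norm_num
  rw [h5]
  have h6 : 0 ≤ r ^ (1 / 2 : ℝ) := by positivity
  calc Real.log (2 * r) * (2 * r) ≤ (3 * r ^ (1 / 2 : ℝ)) * (2 * r) := by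
        gcongr
        have : (2 * r) ^ (1 / 2 : ℝ) / (1 / 2) = 2 * (2 * r) ^ (1 / 2 : ℝ) := by ring
        linarith
    _ = _ := by ring

theorem norm_riemannXi_le :
    ∃ A : ℝ, 0 < A ∧ ∀ s, ‖riemannXi s‖ ≤ Real.exp (A * (1 + ‖s‖) ^ (3 / 2 : ℝ)) := by
  obtain ⟨C, hC, hb⟩ := norm_completedRiemannZeta₀_le_factorial
  refine ⟨C + 3 + 2 + 6, by positivity, fun s => ?_⟩
  set r := 1 + ‖s‖ with hr
  have hr1 : 1 ≤ r := by linarith [norm_nonneg s]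
  set N := ⌈r⌉₊
  have hN1 : r ≤ N := Nat.le_ceil r
  have hN2 : (N : ℝ) ≤ 2 * r := by linarith [Nat.ceil_lt_add_one (show 0 ≤ r by linarith)]
  have hf := factorial_le_exp hr1 hN2
  have hf1 : (1 : ℝ) ≤ N.factorial := by exact_mod_cast Nat.one_le_iff_ne_zero.mpr (Nat.factorial_ne_zero N)
  have h0 := hb s N (by simpa [hr] using hN1)
  have h1 : ‖riemannXi s‖ ≤ 1 + r * r * (C + 2 * (N.factorial : ℝ)) := by
    unfold riemannXi
    refine (norm_sub_le _ _).trans ?_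
    rw [norm_one, norm_mul, norm_mul]
    gcongr
    · linarith
    · exact (norm_sub_le _ _).trans (by simp [hr])
  have hpow : r ≤ r ^ (3 / 2 : ℝ) := by
    conv_lhs => rw [← Real.rpow_one r]
    exact Real.rpow_le_rpow_of_exponent_le hr1 (by norm_num)
  have h2 : 1 + r * r * (C + 2 * (N.factorial : ℝ)) ≤ (C + 3) * (r * r) * N.factorial := by
    have hrr : 1 ≤ r * r := by nlinarith
    have hrf : 1 ≤ (r * r) * N.factorial := by nlinarith
    have hrc : C * (r * r) ≤ C * (r * r) * N.factorial := le_mul_of_one_le_right (by positivity) hf1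
    linarith
  have he : r ≤ Real.exp r := by linarith [Real.add_one_le_exp r]
  have hCe : C + 3 ≤ Real.exp (C + 3) := by linarith [Real.add_one_le_exp (C + 3)]
  calc ‖riemannXi s‖ ≤ (C + 3) * (r * r) * N.factorial := h1.trans h2
    _ ≤ Real.exp (C + 3) * (Real.exp r * Real.exp r) * Real.exp (6 * r ^ (3 / 2 : ℝ)) := by
      gcongr
    _ = Real.exp (C + 3 + (r + r) + 6 * r ^ (3 / 2 : ℝ)) := by simp only [Real.exp_add]
    _ ≤ _ := by
      rw [Real.exp_le_exp]
      have : (C + 3) * 1 ≤ (C + 3) * r ^ (3 / 2 : ℝ) := by gcongr; linarith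
      linarith

theorem exists_riemannXi_eq_zero : ∃ s, riemannXi s = 0 := by
  by_contra! hne
  obtain ⟨A, hA, hb⟩ := norm_riemannXi_le
  obtain ⟨a, b, hab⟩ := exp_affine_of_zero_free differentiable_riemannXi hne hA hb
  have hsymm : ∀ s, riemannXi (1 - s) = riemannXi s := fun s => by
    unfold riemannXi
    rw [completedRiemannZeta₀_one_sub]; ring
  -- The reflection exchanges `(1 - z) / 2` and `(1 + z) / 2`, whose difference is `z`.
  have hone : ∀ z : ℂ, Complex.exp (a * z) = 1 := by
    intro z
    have h := hsymm ((1 - z) / 2)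
    rw [hab, hab] at h
    have h2 : Complex.exp (a * (1 - (1 - z) / 2) + b - (a * ((1 - z) / 2) + b)) = 1 := by
      rw [Complex.exp_sub, h, div_self (Complex.exp_ne_zero _)]
    rw [← h2]; congr 1; ring
  have h0 : riemannXi 0 = 1 := by simp [riemannXi]
  have h2 : riemannXi 2 = 1 := by
    rw [hab] at h0 ⊢
    rw [Complex.exp_add, hone] at h0 ⊢
    exact h0
  have h3 : completedRiemannZeta₀ 2 = 0 := by
    unfold riemannXi at h2
    have : (2 : ℂ) * completedRiemannZeta₀ 2 = 0 := by linear_combination h2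
    simpa using this
  -- With `Λ₀(2) = 0` one gets `ζ(2) = π / 2`; against `π² / 6` this would force `π = 3`.
  have h4 := completedRiemannZeta_eq 2
  have h5 := riemannZeta_def_of_ne_zero (s := 2) two_ne_zero
  rw [riemannZeta_two, h4, h3, Complex.Gammaℝ_def] at h5
  have e1 : (-2 : ℂ) / 2 = -1 := by norm_num
  have e2 : (2 : ℂ) / 2 = 1 := by norm_num
  rw [e1, e2, Complex.Gamma_one, Complex.cpow_neg_one] at h5
  have hpi : (Real.pi : ℂ) ≠ 0 := by exact_mod_cast Real.pi_ne_zero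
  field_simp at h5
  norm_num at h5
  have h6 : Real.pi * 2 = 6 := by exact_mod_cast h5
  linarith [Real.pi_gt_three]

/-- The Riemann zeta function has a zero in the closed right half of the open critical strip. -/
theorem exists_riemannZeta_zero : ∃ s : ℂ, 1 / 2 ≤ s.re ∧ s.re < 1 ∧ riemannZeta s = 0 := by
  obtain ⟨s, hs⟩ := exists_riemannXi_eq_zero
  have hz : ∀ s, riemannXi s = 0 → s.re < 1 ∧ riemannZeta s = 0 := by
    intro s hs
    have h0 : s ≠ 0 := by rintro rfl; simp [riemannXi] at hs
    have h1 : s ≠ 1 := by rintro rfl; simp [riemannXi] at hs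
    have h1' : 1 - s ≠ 0 := sub_ne_zero.mpr h1.symm
    have hc : completedRiemannZeta s = 0 := by
      rw [completedRiemannZeta_eq]
      unfold riemannXi at hs
      field_simp
      linear_combination -hs
    have hz : riemannZeta s = 0 := by rw [riemannZeta_def_of_ne_zero h0, hc, zero_div]
    refine ⟨?_, hz⟩
    by_contra! h
    exact riemannZeta_ne_zero_of_one_le_re h hz
  rcases le_total (1 / 2) s.re with h | h
  · exact ⟨s, h, hz s hs⟩
  · refine ⟨1 - s, by simp; linarith, hz (1 - s) ?_⟩
    unfold riemannXi at hs ⊢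
    rw [completedRiemannZeta₀_one_sub]
    linear_combination hs

/-! ### Zeta as a Mellin transform of the fractional part -/

/-- The fractional part, truncated to `(1, ∞)`. -/
noncomputable def fractTail (t : ℝ) : ℂ := (Ioi (1 : ℝ)).indicator (fun t => ((Int.fract t : ℝ) : ℂ)) t

theorem measurable_fractTail : Measurable fractTail := by
  unfold fractTail
  exact (Complex.measurable_ofReal.comp measurable_fract).indicator measurableSet_Ioi

theorem norm_fractTail_le (t : ℝ) : ‖fractTail t‖ ≤ 1 := by
  unfold fractTail
  by_cases h : t ∈ Ioi (1 : ℝ)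
  · rw [indicator_of_mem h, Complex.norm_real, Real.norm_of_nonneg (Int.fract_nonneg t)]
    exact (Int.fract_lt_one t).le
  · rw [indicator_of_notMem h]; simp

theorem locallyIntegrableOn_fractTail : LocallyIntegrableOn fractTail (Ioi 0) := by
  apply LocallyIntegrable.locallyIntegrableOn
  apply (locallyIntegrable_const (1 : ℂ)).mono measurable_fractTail.aestronglyMeasurable
  filter_upwards with t
  simpa using norm_fractTail_le t

theorem fractTail_isBigO_atTop :
    fractTail =O[Filter.atTop] (fun t : ℝ => t ^ (-0 : ℝ)) := by
  refine Asymptotics.IsBigO.of_bound 1 (Filter.Eventually.of_forall fun t => ?_)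
  simpa using norm_fractTail_le t

theorem fractTail_isBigO_zero (b : ℝ) :
    fractTail =O[nhdsWithin 0 (Ioi 0)] (fun t : ℝ => t ^ (-b)) := by
  refine Asymptotics.IsBigO.of_bound 1 ?_
  have : ∀ᶠ t : ℝ in nhdsWithin 0 (Ioi 0), t < 1 :=
    (eventually_lt_nhds zero_lt_one).filter_mono nhdsWithin_le_nhds
  filter_upwards [this] with t ht
  unfold fractTail
  rw [indicator_of_notMem (by simp; linarith)]
  simp

theorem mellinConvergent_fractTail {s : ℂ} (hs : s.re < 0) : MellinConvergent fractTail s :=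
  mellinConvergent_of_isBigO_rpow locallyIntegrableOn_fractTail fractTail_isBigO_atTop hs
    (fractTail_isBigO_zero (s.re - 1)) (by linarith)

theorem differentiableAt_mellin_fractTail {s : ℂ} (hs : s.re < 0) :
    DifferentiableAt ℂ (mellin fractTail) s :=
  mellin_differentiableAt_of_isBigO_rpow locallyIntegrableOn_fractTail fractTail_isBigO_atTop hs
    (fractTail_isBigO_zero (s.re - 1)) (by linarith)

theorem mellin_fractTail_eq (s : ℂ) :
    mellin fractTail (-s) = ∫ t in Ioi (1 : ℝ), ((Int.fract t : ℝ) : ℂ) * (t : ℂ) ^ (-(s + 1)) := by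
  unfold mellin
  rw [← integral_indicator measurableSet_Ioi, ← integral_indicator measurableSet_Ioi]
  congr 1
  ext t
  by_cases h : t ∈ Ioi (1 : ℝ)
  · have h0 : t ∈ Ioi (0 : ℝ) := by simp at h ⊢; linarith
    rw [indicator_of_mem h0, indicator_of_mem h, fractTail, indicator_of_mem h, smul_eq_mul,
      mul_comm]
    congr 2; ring
  · rw [indicator_of_notMem h]
    by_cases h0 : t ∈ Ioi (0 : ℝ)
    · rw [indicator_of_mem h0, fractTail, indicator_of_notMem h, smul_zero]
    · rw [indicator_of_notMem h0]

theorem integrableOn_fract_mul_cpow {s : ℂ} (hs : 0 < s.re) :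
    IntegrableOn (fun t : ℝ => ((Int.fract t : ℝ) : ℂ) * (t : ℂ) ^ (-(s + 1))) (Ioi 1) := by
  have h := (mellinConvergent_fractTail (s := -s) (by simpa using hs)).mono_set
    (Ioi_subset_Ioi zero_le_one)
  refine h.congr_fun (fun t ht => ?_) measurableSet_Ioi
  simp only [fractTail, indicator_of_mem ht, smul_eq_mul]
  rw [mul_comm]
  congr 2; ring

/-- `ζ(s) = s / (s - 1) - s ∫_1^∞ {t} t ^ (-s-1) dt` for `Re s > 1`. -/
theorem riemannZeta_eq_fract_integral_of_one_lt {s : ℂ} (hs : 1 < s.re) :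
    riemannZeta s = s / (s - 1) - s * mellin fractTail (-s) := by
  have hs0 : 0 < s.re := by linarith
  have hs1 : s - 1 ≠ 0 := fun h => by
    have : s = 1 := by linear_combination h
    rw [this] at hs; simp at hs
  have h := LSeries_eq_mul_integral_of_nonneg (fun _ => 1) zero_le_one (s := s) hs (by
    simp only [Finset.sum_const, Nat.card_Icc, mul_one, nsmul_eq_mul]
    refine Asymptotics.IsBigO.of_bound 1 (Filter.Eventually.of_forall fun n => by simp))
    (fun _ => zero_le_one)
  have hz : LSeries (fun _ => ((1 : ℝ) : ℂ)) s = riemannZeta s := by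
    rw [← LSeries_one_eq_riemannZeta hs]
    congr 1
  rw [hz] at h
  rw [h, mellin_fractTail_eq]
  have hint : ∫ t in Ioi (1 : ℝ), (t : ℂ) ^ (-s) = 1 / (s - 1) := by
    rw [integral_Ioi_cpow_of_lt (by simpa using hs) zero_lt_one]
    have : -s + 1 ≠ 0 := fun h => hs1 (by linear_combination -h)
    simp only [Complex.ofReal_one, Complex.one_cpow]
    rw [neg_div, ← div_neg]
    congr 1
    ring
  have hi1 : IntegrableOn (fun t : ℝ => (t : ℂ) ^ (-s)) (Ioi 1) :=
    integrableOn_Ioi_cpow_of_lt (by simpa using hs) zero_lt_one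
  have : s / (s - 1) = s * (1 / (s - 1)) := by ring
  rw [this, ← mul_sub, ← hint, ← integral_sub hi1 (integrableOn_fract_mul_cpow hs0)]
  congr 1
  refine setIntegral_congr_fun measurableSet_Ioi (fun t ht => ?_)
  have ht : 1 < t := ht
  have ht0 : (t : ℂ) ≠ 0 := by exact_mod_cast (by linarith : t ≠ 0)
  have e1 : (t : ℂ) ^ (-s) = t * (t : ℂ) ^ (-(s + 1)) := by
    rw [show -s = 1 + (-(s + 1)) by ring, Complex.cpow_add _ _ ht0, Complex.cpow_one]
  have e2 : ((⌊t⌋₊ : ℕ) : ℝ) = t - Int.fract t := by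
    rw [natCast_floor_eq_intCast_floor (by linarith)]
    have := Int.self_sub_fract t
    linarith
  simp only [Finset.sum_const, Nat.card_Icc, Complex.ofReal_one, nsmul_eq_mul, mul_one,
    add_tsub_cancel_right]
  rw [e1, ← sub_mul]
  congr 1
  exact_mod_cast e2

/-- Analytic continuation from `Re s > 1`. The pole `1 / (s - 1)` is removed from both sides first,
so the identity theorem applies on the whole convex half-plane `Re s > 0`. -/
theorem riemannZeta_eq_fract_integral {s : ℂ} (hs : 0 < s.re) (hs1 : s ≠ 1) :
    riemannZeta s = s / (s - 1) - s * mellin fractTail (-s) := by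
  have ho : IsOpen {z : ℂ | 0 < z.re} := isOpen_lt continuous_const Complex.continuous_re
  have hmel : ∀ z ∈ {z : ℂ | 0 < z.re}, DifferentiableAt ℂ (fun z => mellin fractTail (-z)) z := by
    intro z hz
    exact (differentiableAt_mellin_fractTail (s := -z) (by simpa using hz)).comp z
      differentiableAt_id.neg
  have hf : DifferentiableOn ℂ riemannZeta₀ {z : ℂ | 0 < z.re} :=
    differentiable_riemannZeta₀.differentiableOn
  have hg : DifferentiableOn ℂ (fun z => 1 - z * mellin fractTail (-z)) {z : ℂ | 0 < z.re} :=
    fun z hz => ((differentiableAt_const _).sub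
      (differentiableAt_id.mul (hmel z hz))).differentiableWithinAt
  have hpre : IsPreconnected {z : ℂ | 0 < z.re} := (convex_halfSpace_re_gt 0).isPreconnected
  have hev : riemannZeta₀ =ᶠ[nhds (2 : ℂ)] (fun z => 1 - z * mellin fractTail (-z)) := by
    have : ∀ᶠ z : ℂ in nhds 2, 1 < z.re :=
      (isOpen_lt continuous_const Complex.continuous_re).mem_nhds (by simp)
    filter_upwards [this] with z hz
    have hz1 : z ≠ 1 := by rintro rfl; simp at hz
    have hz1' : z - 1 ≠ 0 := sub_ne_zero.mpr hz1
    have e := riemannZeta_eq_inv_sub_add hz1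
    rw [riemannZeta_eq_fract_integral_of_one_lt hz] at e
    have : z / (z - 1) = 1 + (z - 1)⁻¹ := by field_simp; ring
    rw [this] at e
    linear_combination -e
  have := (hf.analyticOnNhd ho).eqOn_of_preconnected_of_eventuallyEq (hg.analyticOnNhd ho) hpre
    (show (2 : ℂ) ∈ {z : ℂ | 0 < z.re} by simp) hev hs
  have hz1' : s - 1 ≠ 0 := sub_ne_zero.mpr hs1
  rw [riemannZeta_eq_inv_sub_add hs1, this]
  field_simp
  ring

theorem integral_fract_mul_cpow_Ioc {s : ℂ} (hs1 : s.re < 1) :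
    IntegrableOn (fun t : ℝ => ((Int.fract t : ℝ) : ℂ) * (t : ℂ) ^ (-(s + 1))) (Ioc 0 1) ∧
    ∫ t in Ioc (0 : ℝ) 1, ((Int.fract t : ℝ) : ℂ) * (t : ℂ) ^ (-(s + 1)) = 1 / (1 - s) := by
  have h1 : -1 < (-s).re := by simpa using hs1
  have hae : (fun t : ℝ => (t : ℂ) ^ (-s)) =ᵐ[volume.restrict (Ioc 0 1)]
      (fun t : ℝ => ((Int.fract t : ℝ) : ℂ) * (t : ℂ) ^ (-(s + 1))) := by
    rw [Filter.EventuallyEq, ae_restrict_iff' measurableSet_Ioc]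
    have : ∀ᵐ t : ℝ, t ≠ 1 := by simp [ae_iff]
    filter_upwards [this] with t ht1 ht
    have ht0 : (t : ℂ) ≠ 0 := by exact_mod_cast ht.1.ne'
    rw [Int.fract_eq_self.mpr ⟨ht.1.le, lt_of_le_of_ne ht.2 ht1⟩,
      show -s = 1 + (-(s + 1)) by ring, Complex.cpow_add _ _ ht0, Complex.cpow_one]
  constructor
  · have : IntegrableOn (fun t : ℝ => (t : ℂ) ^ (-s)) (Ioc 0 1) :=
      (intervalIntegrable_iff_integrableOn_Ioc_of_le zero_le_one).mp
        (intervalIntegral.intervalIntegrable_cpow' h1)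
    exact this.congr hae
  · rw [← integral_congr_ae hae, ← intervalIntegral.integral_of_le zero_le_one,
      integral_cpow (Or.inl h1)]
    have : -s + 1 ≠ 0 := fun h => by
      have : s = 1 := by linear_combination -h
      rw [this] at hs1; simp at hs1
    rw [Complex.ofReal_zero, Complex.zero_cpow this]
    simp
    ring

/-- At a zero of `ζ` in the critical strip, `∫_0^∞ {t} t ^ (-s-1) dt` vanishes. -/
theorem integral_fract_mul_cpow_eq_zero {s : ℂ} (hs : 0 < s.re) (hs1 : s.re < 1)
    (hz : riemannZeta s = 0) :
    IntegrableOn (fun t : ℝ => ((Int.fract t : ℝ) : ℂ) * (t : ℂ) ^ (-(s + 1))) (Ioi 0) ∧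
    ∫ t in Ioi (0 : ℝ), ((Int.fract t : ℝ) : ℂ) * (t : ℂ) ^ (-(s + 1)) = 0 := by
  obtain ⟨h1, h2⟩ := integral_fract_mul_cpow_Ioc hs1
  have h3 := integrableOn_fract_mul_cpow hs
  have hne : s ≠ 1 := by rintro rfl; simp at hs1
  have hs0 : s ≠ 0 := by rintro rfl; simp at hs
  have h4 := riemannZeta_eq_fract_integral hs hne
  rw [hz, mellin_fractTail_eq] at h4
  rw [← Ioc_union_Ioi_eq_Ioi zero_le_one]
  refine ⟨h1.union h3, ?_⟩
  rw [setIntegral_union (Ioc_disjoint_Ioi le_rfl) measurableSet_Ioi h1 h3, h2]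
  have h5 : s * ((∫ t in Ioi (1 : ℝ), ((Int.fract t : ℝ) : ℂ) * (t : ℂ) ^ (-(s + 1))) - 1 / (s - 1)) = 0 := by
    linear_combination h4
  have h6 := (mul_eq_zero.mp h5).resolve_left hs0
  have : 1 / (1 - s) = - (1 / (s - 1)) := by
    rw [← neg_sub s 1, div_neg]
  rw [this]
  linear_combination h6

/-! ### Poisson summation and the orthogonal kernel -/

section

open scoped SchwartzMap FourierTransform

theorem SchwartzMap.fourier_fourier_apply (h : 𝓢(ℝ, ℂ)) (x : ℝ) : 𝓕 (𝓕 h) x = h (-x) := by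
  have h1 := SchwartzMap.fourierInv_apply_eq (𝓕 h)
  have h2 : (𝓕⁻ (𝓕 h)) (-x) = h (-x) := by rw [FourierTransform.fourierInv_fourier_eq]
  rw [← h2, h1]
  simp

theorem SchwartzMap.fourier_neg_of_even {h : 𝓢(ℝ, ℂ)} (he : ∀ x, h (-x) = h x) (x : ℝ) :
    𝓕 h (-x) = 𝓕 h x := by
  rw [SchwartzMap.fourier_coe, Real.fourier_eq', Real.fourier_eq', ← integral_neg_eq_self]
  congr 1
  ext v
  simp [he]

theorem integral_Ioi_of_even {f : ℝ → ℂ} (hf : Integrable f) (he : ∀ x, f (-x) = f x) :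
    ∫ x in Ioi (0 : ℝ), f x = (1 / 2) * ∫ x, f x := by
  have h1 : ∫ x in Iic (0 : ℝ), f x = ∫ x in Ioi (0 : ℝ), f x := by
    have := integral_comp_neg_Iic (0 : ℝ) f
    simp only [he, neg_zero] at this
    exact this
  rw [← integral_add_compl (measurableSet_Ioi (a := (0 : ℝ))) hf, compl_Ioi, h1]
  ring

/-- The Poisson summation formula, in the form of the orthogonality of `{x}` to the derivative of
the Fourier transform of a function vanishing at the nonzero integers. -/
theorem integral_fract_mul_deriv_fourier_eq_zero {h : 𝓢(ℝ, ℂ)} (he : ∀ x, h (-x) = h x)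
    (h0 : 𝓕 h 0 = 0) (hn : ∀ n : ℤ, n ≠ 0 → h n = 0) :
    ∫ x in Ioi (0 : ℝ), ((Int.fract x : ℝ) : ℂ) * deriv (⇑(𝓕 h : 𝓢(ℝ, ℂ))) x = 0 := by
  set K : 𝓢(ℝ, ℂ) := 𝓕 h with hK
  have hKe : ∀ x, K (-x) = K x := SchwartzMap.fourier_neg_of_even he
  have hKi : Integrable K := K.integrable
  have hdi : Integrable (deriv K) := (SchwartzMap.derivCLM ℂ ℂ K).integrable
  have hdiff : Differentiable ℝ K := K.differentiable
  have hfi : Integrable (fun x : ℝ => ((Int.fract x : ℝ) : ℂ) * deriv K x) := by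
    refine hdi.norm.mono' ?_ ?_
    · exact (Complex.measurable_ofReal.comp measurable_fract).aestronglyMeasurable.mul
        hdi.aestronglyMeasurable
    · filter_upwards with x
      rw [norm_mul, Complex.norm_real, Real.norm_of_nonneg (Int.fract_nonneg x)]
      exact mul_le_of_le_one_left (norm_nonneg _) (Int.fract_lt_one x).le
  have hsumZ : Summable (fun n : ℤ => K n) :=
    summable_of_isBigO (Real.summable_abs_int_rpow one_lt_two)
      ((K.isBigO_cocompact_rpow (-2)).comp_tendsto Int.tendsto_coe_cofinite)
  have hPoisson : ∑' n : ℤ, K n = h 0 := by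
    have := h.tsum_eq_tsum_fourier 0
    simp only [zero_add, QuotientAddGroup.mk_zero, fourier_eval_zero, mul_one] at this
    rw [← hK] at this
    rw [← this, tsum_eq_single 0 (fun n hn' => hn n hn')]
    simp
  have hKint : ∫ x, K x = h 0 := by
    have h1 := SchwartzMap.fourier_fourier_apply h 0
    rw [SchwartzMap.fourier_coe, Real.fourier_eq', ← hK] at h1
    simpa using h1
  -- Pairing `n` with `-n` counts the index `0` twice, which is harmless because `K 0 = 0`.
  have hsumN : HasSum (fun n : ℕ => K n) (h 0 / 2) := by
    have h1 := hsumZ.hasSum.nat_add_neg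
    rw [hPoisson] at h1
    have h2 := h1.div_const 2
    simp only [Int.cast_natCast, Int.cast_neg, hKe, Int.cast_zero, h0, add_zero] at h2
    simpa using h2
  -- Abel summation. The sum starts at `k = 0`, so the weight is `⌊x⌋ + 1 = x + 1 - {x}`; the
  -- boundary terms at `N` cancel and the one at `0` vanishes with `K 0`. As `N → ∞` the right side
  -- tends to `h 0 / 2 - h 0 / 2`.
  have key : ∀ N : ℕ, ∫ x in (0 : ℝ)..N, ((Int.fract x : ℝ) : ℂ) * deriv K x
      = ∑ k ∈ Finset.range (N + 1), K k - ∫ x in (0 : ℝ)..N, K x := by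
    intro N
    have hN : (0 : ℝ) ≤ N := N.cast_nonneg
    have h1 := sum_mul_eq_sub_integral_mul' (𝕜 := ℂ) (f := K) (fun _ => 1) N
      (fun t _ => hdiff t) hdi.integrableOn
    simp only [mul_one, Finset.sum_const, Nat.card_Icc, nsmul_eq_mul, tsub_zero] at h1
    rw [← intervalIntegral.integral_of_le hN] at h1
    have h2 : ∫ x in (0 : ℝ)..N, ((x : ℂ) + 1) * deriv K x
        = ((N : ℂ) + 1) * K N - ∫ x in (0 : ℝ)..N, K x := by
      have := intervalIntegral.integral_mul_deriv_eq_deriv_mul (a := 0) (b := (N : ℝ))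
        (u := fun x : ℝ => (x : ℂ) + 1) (v := K) (u' := fun _ => 1) (v' := deriv K)
        (fun x _ => by simpa using (Complex.ofRealCLM.hasDerivAt (x := x)).add_const (1 : ℂ))
        (fun x _ => (hdiff x).hasDerivAt) (by simp) hdi.intervalIntegrable
      rw [this]
      simp [h0]
    have hc : Continuous (fun x : ℝ => ((x : ℂ) + 1)) := by fun_prop
    have hi1 : IntervalIntegrable (fun x : ℝ => ((x : ℂ) + 1) * deriv K x) volume 0 N :=
      hdi.intervalIntegrable.continuousOn_mul hc.continuousOn
    have hi2 : IntervalIntegrable (fun x : ℝ => ((Int.fract x : ℝ) : ℂ) * deriv K x) volume 0 N :=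
      hfi.intervalIntegrable
    have h3 : ∫ x in (0 : ℝ)..N, deriv K x * ((⌊x⌋₊ + 1 : ℕ) : ℂ)
        = (∫ x in (0 : ℝ)..N, ((x : ℂ) + 1) * deriv K x)
          - ∫ x in (0 : ℝ)..N, ((Int.fract x : ℝ) : ℂ) * deriv K x := by
      rw [← intervalIntegral.integral_sub hi1 hi2]
      refine intervalIntegral.integral_congr (fun x hx => ?_)
      rw [uIcc_of_le hN] at hx
      have e2 : ((⌊x⌋₊ : ℕ) : ℝ) = x - Int.fract x := by
        rw [natCast_floor_eq_intCast_floor hx.1]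
        have := Int.self_sub_fract x
        linarith
      have e3 : ((⌊x⌋₊ : ℕ) : ℂ) = x - (Int.fract x : ℝ) := by exact_mod_cast e2
      push_cast
      rw [e3]; ring
    rw [h3, h2] at h1
    rw [Nat.range_succ_eq_Icc_zero, h1]
    push_cast
    ring
  have hl1 := intervalIntegral_tendsto_integral_Ioi 0 hfi.integrableOn tendsto_natCast_atTop_atTop
  have hl2 := intervalIntegral_tendsto_integral_Ioi 0 hKi.integrableOn tendsto_natCast_atTop_atTop
  have hl3 := (hsumN.tendsto_sum_nat.comp (Filter.tendsto_add_atTop_nat 1)).sub hl2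
  rw [integral_Ioi_of_even hKi hKe, hKint] at hl3
  have := tendsto_nhds_unique hl1 (hl3.congr (fun N => (key N).symm))
  rw [this]; ring

/-- Apply the undilated statement to `x ↦ h (T x)`: as `T ≥ B`, every nonzero integer is sent
outside the support of `h`. -/
theorem integral_fract_mul_mul_deriv_fourier_eq_zero {h : 𝓢(ℝ, ℂ)} (he : ∀ x, h (-x) = h x)
    (h0 : 𝓕 h 0 = 0) {B : ℝ} (hB : 0 < B) (hs : ∀ x, B ≤ |x| → h x = 0) {T : ℝ} (hT : B ≤ T) :
    ∫ x in Ioi (0 : ℝ), ((Int.fract (T * x) : ℝ) : ℂ) * deriv (⇑(𝓕 h : 𝓢(ℝ, ℂ))) x = 0 := by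
  have hT0 : 0 < T := hB.trans_le hT
  set g : 𝓢(ℝ, ℂ) := SchwartzMap.compCLMOfContinuousLinearEquiv ℂ
    (ContinuousLinearEquiv.smulLeft (Units.mk0 T hT0.ne')) h with hg
  have hgx : ∀ x, g x = h (T * x) := fun x => by
    simp [hg]
  have hF : ∀ x, 𝓕 g x = (T⁻¹ : ℂ) * 𝓕 h (T⁻¹ * x) := by
    intro x
    rw [SchwartzMap.fourier_coe, SchwartzMap.fourier_coe, Real.fourier_eq', Real.fourier_eq']
    have := Measure.integral_comp_mul_left (fun v : ℝ =>
      Complex.exp (((-2 * Real.pi * inner ℝ v (T⁻¹ * x) : ℝ) : ℂ) * Complex.I) • h v) T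
    rw [abs_of_pos (inv_pos.mpr hT0)] at this
    simp only [hgx]
    have e : (T⁻¹ : ℂ) = ((T⁻¹ : ℝ) : ℂ) := by push_cast; rfl
    rw [e, ← Complex.real_smul, ← this]
    congr 1
    ext v
    congr 4
    simp only [RCLike.inner_apply, conj_trivial]
    field_simp
  have hd : ∀ x, deriv (⇑(𝓕 g : 𝓢(ℝ, ℂ))) x = (T⁻¹ : ℂ) * (T⁻¹ * deriv (⇑(𝓕 h : 𝓢(ℝ, ℂ))) (T⁻¹ * x)) := by
    intro x
    have h1 : HasDerivAt (fun x => (T⁻¹ : ℂ) * 𝓕 h (T⁻¹ * x))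
        ((T⁻¹ : ℂ) * (T⁻¹ * deriv (⇑(𝓕 h : 𝓢(ℝ, ℂ))) (T⁻¹ * x))) x := by
      have h2 := ((𝓕 h).hasDerivAt (T⁻¹ * x)).scomp x ((hasDerivAt_id x).const_mul T⁻¹)
      refine (h2.const_mul (T⁻¹ : ℂ)).congr_deriv ?_
      simp
    have : (⇑(𝓕 g : 𝓢(ℝ, ℂ))) = (fun x => (T⁻¹ : ℂ) * 𝓕 h (T⁻¹ * x)) := funext hF
    rw [this]
    exact h1.deriv
  have hz := integral_fract_mul_deriv_fourier_eq_zero (h := g) (fun x => by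
      rw [hgx, hgx, mul_neg, he]) (by rw [hF]; simp [h0]) (fun n hn => by
      rw [hgx]
      apply hs
      rw [abs_mul, abs_of_pos hT0]
      have : (1 : ℝ) ≤ |(n : ℝ)| := by exact_mod_cast Int.one_le_abs hn
      nlinarith)
  simp only [hd] at hz
  have hcv := integral_comp_mul_left_Ioi' (fun x : ℝ => ((Int.fract x : ℝ) : ℂ) *
    ((T⁻¹ : ℂ) * (T⁻¹ * deriv (⇑(𝓕 h : 𝓢(ℝ, ℂ))) (T⁻¹ * x)))) 0 hT0
  rw [mul_zero, hz] at hcv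
  have hcv2 := (smul_eq_zero.mp hcv).resolve_left hT0.ne'
  have hTc : (T : ℂ) ≠ 0 := by exact_mod_cast hT0.ne'
  have hcv3 : ∫ x in Ioi (0 : ℝ), ((T⁻¹ : ℂ) * T⁻¹) *
      (((Int.fract (T * x) : ℝ) : ℂ) * deriv (⇑(𝓕 h : 𝓢(ℝ, ℂ))) x) = 0 := by
    rw [← hcv2]
    congr 1
    ext x
    rw [inv_mul_cancel_left₀ hT0.ne']
    ring
  rw [integral_const_mul] at hcv3
  exact (mul_eq_zero.mp hcv3).resolve_left (by simp [hTc])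

theorem SchwartzMap.integrableOn_mul_cpow (k : 𝓢(ℝ, ℂ)) {z : ℂ} (hz : -1 < z.re) :
    IntegrableOn (fun y : ℝ => k y * (y : ℂ) ^ z) (Ioi 0) := by
  have h : MellinConvergent k (z + 1) := by
    refine mellinConvergent_of_isBigO_rpow (a := (z + 1).re + 1) (b := 0)
      (k.continuous.locallyIntegrable.locallyIntegrableOn _) ?_ (by linarith) ?_
      (by simp; linarith)
    · have := (k.isBigO_cocompact_rpow (-((z + 1).re + 1))).mono atTop_le_cocompact
      refine this.congr' Filter.EventuallyEq.rfl ?_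
      filter_upwards [Filter.eventually_gt_atTop 0] with t ht
      rw [Real.norm_of_nonneg ht.le]
    · simp only [neg_zero, Real.rpow_zero]
      exact (k.continuous.continuousAt.isBigO_one ℝ).mono nhdsWithin_le_nhds
  refine h.congr_fun (fun t _ => ?_) measurableSet_Ioi
  simp only [smul_eq_mul, add_sub_cancel_right]
  ring

theorem SchwartzMap.integral_deriv_mul_cpow (k : 𝓢(ℝ, ℂ)) {s : ℂ} (hs : 0 < s.re) :
    ∫ y in Ioi (0 : ℝ), deriv k y * (y : ℂ) ^ s
      = -s * ∫ y in Ioi (0 : ℝ), k y * (y : ℂ) ^ (s - 1) := by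
  have hs0 : s ≠ 0 := by rintro rfl; simp at hs
  have hcont : Continuous (fun y : ℝ => (y : ℂ) ^ s) := Complex.continuous_ofReal_cpow_const hs
  have i1 : IntegrableOn (fun y : ℝ => deriv k y * (y : ℂ) ^ s) (Ioi 0) :=
    (SchwartzMap.derivCLM ℂ ℂ k).integrableOn_mul_cpow (by linarith)
  have i2 : IntegrableOn (fun y : ℝ => k y * (y : ℂ) ^ (s - 1)) (Ioi 0) :=
    k.integrableOn_mul_cpow (by simp; linarith)
  have := integral_Ioi_mul_deriv_eq_deriv_mul (a := 0) (a' := 0) (b' := 0)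
    (u := fun y : ℝ => (y : ℂ) ^ s) (u' := fun y : ℝ => s * (y : ℂ) ^ (s - 1)) (v := k)
    (v' := deriv k) (fun x hx => hasDerivAt_ofReal_cpow_const (ne_of_gt hx) hs0)
    (fun x _ => k.hasDerivAt x)
    (i1.congr_fun (fun y _ => by simp [mul_comm]) measurableSet_Ioi)
    (IntegrableOn.congr_fun (i2.const_mul s) (fun y _ => by simp only [Pi.mul_apply]; ring) measurableSet_Ioi)
    (by
      have : Continuous ((fun y : ℝ => (y : ℂ) ^ s) * ⇑k) := hcont.mul k.continuous
      have h2 := (this.tendsto 0).mono_left (nhdsWithin_le_nhds (s := Ioi 0))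
      simpa [Complex.zero_cpow hs0] using h2)
    (by
      rw [tendsto_zero_iff_norm_tendsto_zero]
      have h1 := (k.isBigO_cocompact_rpow (-(s.re + 1))).mono atTop_le_cocompact
      have h2 : (fun y : ℝ => ‖((fun y : ℝ => (y : ℂ) ^ s) * ⇑k) y‖) =O[Filter.atTop]
          (fun y : ℝ => y ^ (-1 : ℝ)) := by
        have h3 := ((Asymptotics.isBigO_refl (fun y : ℝ => y ^ s.re) Filter.atTop).mul
          h1.norm_left)
        refine h3.congr' ?_ ?_
        · filter_upwards [Filter.eventually_gt_atTop 0] with t ht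
          rw [Pi.mul_apply, norm_mul, Complex.norm_cpow_eq_rpow_re_of_pos ht]
        · filter_upwards [Filter.eventually_gt_atTop 0] with t ht
          rw [Real.norm_of_nonneg ht.le, ← Real.rpow_add ht]
          congr 1; ring
      exact h2.trans_tendsto (tendsto_rpow_neg_atTop one_pos))
  have e1 : ∫ y in Ioi (0 : ℝ), deriv k y * (y : ℂ) ^ s
      = ∫ y in Ioi (0 : ℝ), (y : ℂ) ^ s * deriv k y := by
    congr 1; ext y; ring
  have e2 : ∫ y in Ioi (0 : ℝ), s * (y : ℂ) ^ (s - 1) * k y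
      = s * ∫ y in Ioi (0 : ℝ), k y * (y : ℂ) ^ (s - 1) := by
    rw [← integral_const_mul]
    congr 1; ext y; ring
  rw [e1, this, e2]
  ring

/-- The symmetrized exponential second difference has a nonvanishing Mellin moment against an even
function which does not vanish near the origin, for some frequency. -/
theorem exists_mellin_second_difference_ne_zero {β : 𝓢(ℝ, ℂ)} (he : ∀ x, β (-x) = β x)
    (hβ : β 0 ≠ 0) {s : ℂ} (hs : 0 < s.re) :
    ∃ c : ℝ, ∫ y in Ioi (0 : ℝ), (β y * (((𝐞 (-(y * c)) : Circle) : ℂ) + ((𝐞 (y * c) : Circle) : ℂ) - 2)) * (y : ℂ) ^ (s - 1) ≠ 0 := by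
  by_contra! hc
  set u : ℝ → ℂ := fun y => β y * ((|y| : ℝ) : ℂ) ^ (s - 1) with hu
  have hue : ∀ y, u (-y) = u y := fun y => by simp [hu, he]
  have hui : Integrable u := by
    have h1 : IntegrableOn u (Ioi 0) := by
      refine (β.integrableOn_mul_cpow (z := s - 1) (by simp; linarith)).congr_fun
        (fun y hy => ?_) measurableSet_Ioi
      simp [hu, abs_of_pos (mem_Ioi.mp hy)]
    have h2 : IntegrableOn u (Iic 0) := by
      have := (integrableOn_Ici_iff_integrableOn_Ioi (f := u) (b := 0)).mpr h1
      have h3 := this.comp_neg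
      simp only [hue] at h3
      simpa using h3
    rw [← integrableOn_univ, ← Iic_union_Ioi (a := (0 : ℝ))]
    exact h2.union h1
  have hF : ∀ c, 𝓕 u c = ∫ y, ((𝐞 (-(y * c)) : Circle) : ℂ) * u y := by
    intro c
    rw [Real.fourier_real_eq]
    rfl
  have hi : ∀ c : ℝ, Integrable (fun y => ((𝐞 (-(y * c)) : Circle) : ℂ) * u y) := by
    intro c
    refine hui.norm.mono' ?_ (Filter.Eventually.of_forall fun y => by
      rw [norm_mul, Circle.norm_coe, one_mul])
    refine AEStronglyMeasurable.mul ?_ hui.aestronglyMeasurable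
    have : Continuous (fun y : ℝ => ((𝐞 (-(y * c)) : Circle) : ℂ)) := by
      have := Real.continuous_fourierChar
      fun_prop
    exact this.aestronglyMeasurable
  have hFe : ∀ c, 𝓕 u (-c) = 𝓕 u c := by
    intro c
    rw [hF, hF, ← integral_neg_eq_self]
    congr 1
    ext y
    rw [hue]; simp
  -- By evenness the vanishing moment says `𝓕 u c + 𝓕 u (-c) - 2 𝓕 u 0 = 0`, with `𝓕 u` even.
  have hconst : ∀ c, 𝓕 u c = 𝓕 u 0 := by
    intro c
    have h1 : ∫ y, (((fun y : ℝ => ((𝐞 (-(y * c)) : Circle) : ℂ) * u y) + (fun y : ℝ => ((𝐞 (-(y * -c)) : Circle) : ℂ) * u y)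
        - (fun y : ℝ => 2 * (((𝐞 (-(y * 0)) : Circle) : ℂ) * u y)))) y
        = 2 * 𝓕 u c - 2 * 𝓕 u 0 := by
      rw [integral_sub' ((hi c).add (hi (-c))) ((hi 0).const_mul 2), integral_add' (hi c) (hi (-c)),
        integral_const_mul, ← hF, ← hF, ← hF, hFe]
      ring
    have h2 := integral_Ioi_of_even (((hi c).add (hi (-c))).sub ((hi 0).const_mul 2)) (fun y => by
      simp only [Pi.sub_apply, Pi.add_apply, hue]
      simp
      ring)
    have h3 := hc c
    have h4 : ∫ y in Ioi (0 : ℝ), (β y * (((𝐞 (-(y * c)) : Circle) : ℂ) + ((𝐞 (y * c) : Circle) : ℂ) - 2)) * (y : ℂ) ^ (s - 1)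
        = ∫ y in Ioi (0 : ℝ), ((fun y => ((𝐞 (-(y * c)) : Circle) : ℂ) * u y) + (fun y => ((𝐞 (-(y * -c)) : Circle) : ℂ) * u y)
        - (fun y => 2 * (((𝐞 (-(y * 0)) : Circle) : ℂ) * u y))) y := by
      refine setIntegral_congr_fun measurableSet_Ioi (fun y hy => ?_)
      simp only [Pi.sub_apply, Pi.add_apply, hu, abs_of_pos (mem_Ioi.mp hy)]
      simp
      ring
    rw [h4, h2] at h3
    rw [h1] at h3
    linear_combination h3
  -- Riemann–Lebesgue: a constant Fourier transform must be zero.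
  have hzero : 𝓕 u 0 = 0 := by
    have h1 := Real.zero_at_infty_fourier u
    have h2 : (𝓕 u) = fun _ => 𝓕 u 0 := funext hconst
    rw [h2] at h1
    exact tendsto_nhds_unique tendsto_const_nhds h1
  have hall : 𝓕 u = fun _ => 0 := funext fun c => by rw [hconst, hzero]
  have huz : ∀ y : ℝ, 0 < y → u y = 0 := by
    intro y hy
    have hca : ContinuousAt u y := by
      refine β.continuous.continuousAt.mul ?_
      refine ContinuousAt.comp (g := fun x : ℝ => (x : ℂ) ^ (s - 1)) ?_ continuous_abs.continuousAt
      exact Complex.continuousAt_ofReal_cpow_const _ _ (Or.inr (by simpa using hy.ne'))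
    have := hui.fourierInv_fourier_eq (by rw [hall]; exact integrable_zero _ _ _) hca
    rw [← this, hall, Real.fourierInv_eq]
    simp
  have hβz : ∀ y : ℝ, 0 < y → β y = 0 := by
    intro y hy
    have h1 := huz y hy
    simp only [hu, abs_of_pos hy] at h1
    refine (mul_eq_zero.mp h1).resolve_right ?_
    rw [Complex.cpow_def_of_ne_zero (by exact_mod_cast hy.ne')]
    exact Complex.exp_ne_zero _
  have hlim := (β.continuous.tendsto 0).mono_left (nhdsWithin_le_nhds (s := Ioi 0))
  refine hβ (tendsto_nhds_unique hlim (tendsto_const_nhds.congr' ?_))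
  filter_upwards [self_mem_nhdsWithin] with y hy
  exact (hβz y hy).symm

theorem exists_even_schwartz_bump :
    ∃ b : 𝓢(ℝ, ℂ), (∀ x, b (-x) = b x) ∧ (∀ x, 2 ≤ |x| → b x = 0) ∧ 𝓕 b 0 ≠ 0 := by
  let f : ContDiffBump (0 : ℝ) := ⟨1, 2, one_pos, one_lt_two⟩
  have hcs : HasCompactSupport (fun x => ((f x : ℝ) : ℂ)) :=
    f.hasCompactSupport.comp_left (g := fun x : ℝ => (x : ℂ)) (by simp)
  have hcd : ContDiff ℝ (⊤ : ℕ∞) (fun x => ((f x : ℝ) : ℂ)) :=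
    Complex.ofRealCLM.contDiff.comp f.contDiff
  refine ⟨hcs.toSchwartzMap hcd, fun x => ?_, fun x hx => ?_, ?_⟩
  · change ((f (-x) : ℝ) : ℂ) = ((f x : ℝ) : ℂ)
    rw [f.neg]
  · change ((f x : ℝ) : ℂ) = 0
    rw [f.zero_of_le_dist (by simpa using hx)]
    simp
  · rw [SchwartzMap.fourier_coe, Real.fourier_eq']
    have : ∫ x, ((f x : ℝ) : ℂ) = ((∫ x, f x : ℝ) : ℂ) := integral_ofReal
    have hpos : 0 < ∫ x, f x := f.integral_pos
    simp only [inner_zero_right, mul_zero, Complex.ofReal_zero, zero_mul, Complex.exp_zero,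
      one_smul]
    change ∫ x, ((f x : ℝ) : ℂ) ≠ 0
    rw [this]
    exact_mod_cast hpos.ne'

theorem SchwartzMap.fourier_compSubConstCLM (b : 𝓢(ℝ, ℂ)) (c x : ℝ) :
    𝓕 (SchwartzMap.compSubConstCLM ℂ c b) x = ((𝐞 (-(x * c)) : Circle) : ℂ) * 𝓕 b x := by
  rw [SchwartzMap.fourier_coe, SchwartzMap.fourier_coe, Real.fourier_real_eq, Real.fourier_real_eq,
    ← integral_const_mul, ← integral_add_right_eq_self _ c]
  congr 1
  ext v
  simp only [SchwartzMap.compSubConstCLM_apply, add_sub_cancel_right, Circle.smul_def, smul_eq_mul]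
  rw [← mul_assoc, ← Circle.coe_mul, ← AddChar.map_add_eq_mul]
  congr 3
  ring

/-- A kernel orthogonal to the dilated fractional parts `{T x}`, `T ≥ B`, whose Mellin transform does
not vanish at a given point. -/
theorem exists_kernel {s : ℂ} (hs : 0 < s.re) :
    ∃ (m : 𝓢(ℝ, ℂ)) (B : ℝ), 0 < B ∧
      (∀ T, B ≤ T → ∫ x in Ioi (0 : ℝ), ((Int.fract (T * x) : ℝ) : ℂ) * m x = 0) ∧
      ∫ y in Ioi (0 : ℝ), m y * (y : ℂ) ^ s ≠ 0 := by
  obtain ⟨b, hbe, hbs, hb0⟩ := exists_even_schwartz_bump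
  obtain ⟨c, hc⟩ := exists_mellin_second_difference_ne_zero
    (SchwartzMap.fourier_neg_of_even hbe) hb0 hs
  -- The second difference multiplies `𝓕 b` by `2 cos (2πxc) - 2`, which vanishes at `0`, while the
  -- support stays within `|x| ≤ 2 + |c|`.
  set h : 𝓢(ℝ, ℂ) := SchwartzMap.compSubConstCLM ℂ c b + SchwartzMap.compSubConstCLM ℂ (-c) b
    + (-2 : ℂ) • b with hh
  have hx : ∀ x, h x = b (x - c) + b (x + c) - 2 * b x := fun x => by
    simp [hh]
    ring
  have hF : ∀ x, 𝓕 h x = 𝓕 b x * (((𝐞 (-(x * c)) : Circle) : ℂ) + ((𝐞 (x * c) : Circle) : ℂ) - 2) := by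
    intro x
    have : 𝓕 h = 𝓕 (SchwartzMap.compSubConstCLM ℂ c b) + 𝓕 (SchwartzMap.compSubConstCLM ℂ (-c) b)
        + (-2 : ℂ) • 𝓕 b := by
      rw [hh, FourierTransform.fourier_add, FourierTransform.fourier_add,
        FourierTransform.fourier_smul]
    rw [this]
    simp only [add_apply, smul_apply,
      SchwartzMap.fourier_compSubConstCLM, smul_eq_mul, mul_neg, neg_neg]
    ring
  have hhe : ∀ x, h (-x) = h x := fun x => by
    rw [hx, hx, ← hbe (-x - c), ← hbe (-x + c), hbe x]
    simp only [neg_sub, neg_add, neg_neg, sub_neg_eq_add]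
    rw [add_comm c x, ← sub_eq_add_neg]
    ring
  refine ⟨SchwartzMap.derivCLM ℂ ℂ (𝓕 h), 2 + |c|, by positivity, fun T hT => ?_, ?_⟩
  · refine integral_fract_mul_mul_deriv_fourier_eq_zero hhe (by rw [hF]; simp; norm_num)
      (by positivity) (fun x hxB => ?_) hT
    rw [hx, hbs, hbs, hbs]
    · simp
    · linarith [abs_nonneg c]
    · have := abs_sub_abs_le_abs_sub x (-c)
      rw [abs_neg, sub_neg_eq_add] at this
      linarith
    · have := abs_sub_abs_le_abs_sub x c
      linarith
  · simp only [SchwartzMap.derivCLM_apply]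
    rw [SchwartzMap.integral_deriv_mul_cpow _ hs]
    simp only [hF]
    refine mul_ne_zero (neg_ne_zero.mpr ?_) hc
    rintro rfl; simp at hs

/-! ### Cutting off the power at a zero of zeta -/

/-- The average `∫_0^1 m(xu) u ^ s du`. -/
noncomputable def mellinHead (m : ℝ → ℂ) (s : ℂ) (x : ℝ) : ℂ :=
  ∫ u in Ioc (0 : ℝ) 1, m (x * u) * (u : ℂ) ^ s

/-- The function `x ^ (-s-1) ∫_x^∞ m(y) y ^ s dy`, expressed through `mellinHead`. -/
noncomputable def mellinTail (m : ℝ → ℂ) (s : ℂ) (x : ℝ) : ℂ :=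
  (∫ y in Ioi (0 : ℝ), m y * (y : ℂ) ^ s) * (x : ℂ) ^ (-(s + 1)) - mellinHead m s x

theorem integrable_prod_comp_mul (m : 𝓢(ℝ, ℂ)) {s : ℂ} (hs : 0 < s.re) :
    Integrable (fun p : ℝ × ℝ => m (p.1 * p.2) * (p.2 : ℂ) ^ s)
      ((volume.restrict (Ioi 0)).prod (volume.restrict (Ioc 0 1))) := by
  have hcpow : Continuous (fun u : ℝ => (u : ℂ) ^ s) := Complex.continuous_ofReal_cpow_const hs
  have hc : Continuous (fun p : ℝ × ℝ => m (p.1 * p.2) * (p.2 : ℂ) ^ s) := by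
    have h1 : Continuous (fun p : ℝ × ℝ => m (p.1 * p.2)) := m.continuous.comp (by fun_prop)
    exact h1.mul (hcpow.comp continuous_snd)
  rw [integrable_prod_iff' hc.aestronglyMeasurable]
  constructor
  · rw [ae_restrict_iff' measurableSet_Ioc]
    filter_upwards with u hu
    refine Integrable.mul_const ?_ _
    exact (m.integrable.comp_mul_right' hu.1.ne').integrableOn
  · have hpow : IntegrableOn (fun u : ℝ => u ^ (s.re - 1)) (Ioc 0 1) :=
      (intervalIntegrable_iff_integrableOn_Ioc_of_le zero_le_one).mp
        (intervalIntegral.intervalIntegrable_rpow' (by linarith))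
    have h2 := hpow.mul_const (∫ x in Ioi (0 : ℝ), ‖m x‖)
    refine IntegrableOn.congr_fun h2 (fun u hu => ?_) measurableSet_Ioc
    have hu0 : 0 < u := hu.1
    simp only [norm_mul, Complex.norm_cpow_eq_rpow_re_of_pos hu0]
    -- Rescaling in `x` costs `u⁻¹`, leaving `u^(Re s - 1)`, integrable at `0` because `Re s > 0`.
    rw [integral_mul_const, integral_comp_mul_right_Ioi (fun x => ‖m x‖) 0 hu0, zero_mul,
      smul_eq_mul, Real.rpow_sub hu0, Real.rpow_one]
    field_simp

theorem integrableOn_mellinHead (m : 𝓢(ℝ, ℂ)) {s : ℂ} (hs : 0 < s.re) :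
    IntegrableOn (mellinHead m s) (Ioi 0) :=
  (integrable_prod_comp_mul m hs).integral_prod_left

theorem integrableOn_fract_mul {f : ℝ → ℂ} {S : Set ℝ} (hf : IntegrableOn f S) (T : ℝ) :
    IntegrableOn (fun x => ((Int.fract (T * x) : ℝ) : ℂ) * f x) S := by
  refine Integrable.mono' (Integrable.norm hf) ?_ ?_
  · refine AEStronglyMeasurable.mul ?_ hf.aestronglyMeasurable
    exact (Complex.measurable_ofReal.comp (measurable_fract.comp
      (measurable_const_mul T))).aestronglyMeasurable
  · filter_upwards with x
    rw [norm_mul, Complex.norm_real, Real.norm_of_nonneg (Int.fract_nonneg _)]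
    exact mul_le_of_le_one_left (norm_nonneg _) (Int.fract_lt_one _).le

/-- By Fubini and rescaling, each slice tests `m` against the dilation `T / u`, and `T / u ≥ T ≥ B`
because `u ≤ 1`. -/
theorem integral_fract_mul_mellinHead_eq_zero (m : 𝓢(ℝ, ℂ)) {s : ℂ} (hs : 0 < s.re) {B T : ℝ}
    (hB : 0 < B) (hT : B ≤ T)
    (hm : ∀ T, B ≤ T → ∫ x in Ioi (0 : ℝ), ((Int.fract (T * x) : ℝ) : ℂ) * m x = 0) :
    ∫ x in Ioi (0 : ℝ), ((Int.fract (T * x) : ℝ) : ℂ) * mellinHead m s x = 0 := by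
  have hint : Integrable (fun p : ℝ × ℝ => ((Int.fract (T * p.1) : ℝ) : ℂ) *
      (m (p.1 * p.2) * (p.2 : ℂ) ^ s))
      ((volume.restrict (Ioi 0)).prod (volume.restrict (Ioc 0 1))) := by
    have h := integrable_prod_comp_mul m hs
    refine Integrable.mono' h.norm ?_ ?_
    · refine AEStronglyMeasurable.mul ?_ h.aestronglyMeasurable
      exact (Complex.measurable_ofReal.comp (measurable_fract.comp
        (measurable_fst.const_mul T))).aestronglyMeasurable
    · filter_upwards with x
      rw [norm_mul, Complex.norm_real, Real.norm_of_nonneg (Int.fract_nonneg _)]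
      exact mul_le_of_le_one_left (norm_nonneg _) (Int.fract_lt_one _).le
  have h1 : ∫ x in Ioi (0 : ℝ), ((Int.fract (T * x) : ℝ) : ℂ) * mellinHead m s x
      = ∫ x in Ioi (0 : ℝ), ∫ u in Ioc (0 : ℝ) 1, ((Int.fract (T * x) : ℝ) : ℂ) *
        (m (x * u) * (u : ℂ) ^ s) := by
    simp only [integral_const_mul, mellinHead]
  rw [h1, integral_integral_swap hint]
  rw [setIntegral_congr_fun (g := fun _ => 0) measurableSet_Ioc, integral_zero]
  intro u hu
  have hu0 : 0 < u := hu.1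
  have hT0 : 0 < T := hB.trans_le hT
  beta_reduce
  have h2 := integral_comp_mul_right_Ioi
    (fun z : ℝ => ((Int.fract (T / u * z) : ℝ) : ℂ) * m z) 0 hu0
  rw [zero_mul, hm (T / u) (hT.trans (by
    rw [le_div_iff₀ hu0]; exact mul_le_of_le_one_right hT0.le hu.2)), smul_zero] at h2
  have h3 : ∀ x : ℝ, T / u * (x * u) = T * x := fun x => by field_simp
  simp only [h3] at h2
  simp only [← mul_assoc]
  rw [integral_mul_const, h2, zero_mul]

/-- Both pieces of `mellinTail` are orthogonal to `{T x}`: the power because `ζ(s) = 0`, the head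
because of `m`. -/
theorem integral_fract_mul_mellinTail_eq_zero (m : 𝓢(ℝ, ℂ)) {s : ℂ} (hs : 0 < s.re)
    (hs1 : s.re < 1) (hz : riemannZeta s = 0) {B T : ℝ} (hB : 0 < B) (hT : B ≤ T)
    (hm : ∀ T, B ≤ T → ∫ x in Ioi (0 : ℝ), ((Int.fract (T * x) : ℝ) : ℂ) * m x = 0) :
    IntegrableOn (fun x => ((Int.fract (T * x) : ℝ) : ℂ) * mellinTail m s x) (Ioi 0) ∧
    ∫ x in Ioi (0 : ℝ), ((Int.fract (T * x) : ℝ) : ℂ) * mellinTail m s x = 0 := by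
  have hT0 : 0 < T := hB.trans_le hT
  obtain ⟨hi, hI⟩ := integral_fract_mul_cpow_eq_zero hs hs1 hz
  set κ := ∫ y in Ioi (0 : ℝ), m y * (y : ℂ) ^ s
  have hTc : (T : ℂ) ^ (-(s + 1)) ≠ 0 := by
    rw [Complex.cpow_def_of_ne_zero (by exact_mod_cast hT0.ne')]
    exact Complex.exp_ne_zero _
  have e : ∀ x ∈ Ioi (0 : ℝ), ((Int.fract (T * x) : ℝ) : ℂ) * ((T * x : ℝ) : ℂ) ^ (-(s + 1))
      = (T : ℂ) ^ (-(s + 1)) * (((Int.fract (T * x) : ℝ) : ℂ) * (x : ℂ) ^ (-(s + 1))) := by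
    intro x hx
    rw [Complex.ofReal_mul, Complex.mul_cpow_ofReal_nonneg hT0.le (mem_Ioi.mp hx).le]
    ring
  have hi2 : IntegrableOn (fun x : ℝ => ((Int.fract (T * x) : ℝ) : ℂ) * (x : ℂ) ^ (-(s + 1)))
      (Ioi 0) := by
    have h1 : IntegrableOn (fun x : ℝ => ((Int.fract (T * x) : ℝ) : ℂ) *
        ((T * x : ℝ) : ℂ) ^ (-(s + 1))) (Ioi 0) := by
      have := (integrableOn_Ioi_comp_mul_left_iff
        (fun t : ℝ => ((Int.fract t : ℝ) : ℂ) * (t : ℂ) ^ (-(s + 1))) 0 hT0).mpr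
      rw [mul_zero] at this
      exact this hi
    have h2 := (IntegrableOn.congr_fun h1 e measurableSet_Ioi).const_mul ((T : ℂ) ^ (-(s + 1)))⁻¹
    refine IntegrableOn.congr_fun h2 (fun x _ => ?_) measurableSet_Ioi
    rw [inv_mul_cancel_left₀ hTc]
  have hI2 : ∫ x in Ioi (0 : ℝ), ((Int.fract (T * x) : ℝ) : ℂ) * (x : ℂ) ^ (-(s + 1)) = 0 := by
    have h1 := integral_comp_mul_left_Ioi
      (fun t : ℝ => ((Int.fract t : ℝ) : ℂ) * (t : ℂ) ^ (-(s + 1))) 0 hT0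
    rw [mul_zero, hI, smul_zero, setIntegral_congr_fun measurableSet_Ioi e,
      integral_const_mul] at h1
    exact (mul_eq_zero.mp h1).resolve_left hTc
  have hih := integrableOn_fract_mul (integrableOn_mellinHead m hs) T
  have hfun : (fun x => ((Int.fract (T * x) : ℝ) : ℂ) * mellinTail m s x) = fun x : ℝ =>
      κ * (((Int.fract (T * x) : ℝ) : ℂ) * (x : ℂ) ^ (-(s + 1))) -
        ((Int.fract (T * x) : ℝ) : ℂ) * mellinHead m s x := by
    ext x
    simp only [mellinTail]
    ring
  rw [hfun]
  refine ⟨(hi2.const_mul κ).sub hih, ?_⟩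
  rw [integral_sub (hi2.const_mul κ) hih, integral_const_mul, hI2,
    integral_fract_mul_mellinHead_eq_zero m hs hB hT hm]
  simp

theorem mellinTail_eq (m : 𝓢(ℝ, ℂ)) {s : ℂ} (hs : 0 < s.re) {x : ℝ} (hx : 0 < x) :
    mellinTail m s x = (x : ℂ) ^ (-(s + 1)) * ∫ y in Ioi x, m y * (y : ℂ) ^ s := by
  have hi : IntegrableOn (fun y : ℝ => m y * (y : ℂ) ^ s) (Ioi 0) :=
    m.integrableOn_mul_cpow (by linarith)
  have hxc : (x : ℂ) ≠ 0 := by exact_mod_cast hx.ne'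
  have h1 : mellinHead m s x = (x : ℂ) ^ (-(s + 1)) * ∫ y in Ioc 0 x, m y * (y : ℂ) ^ s := by
    unfold mellinHead
    rw [← intervalIntegral.integral_of_le zero_le_one, ← intervalIntegral.integral_of_le hx.le]
    have := intervalIntegral.integral_comp_mul_left (a := 0) (b := 1)
      (fun y : ℝ => m y * (y : ℂ) ^ s) hx.ne'
    rw [mul_zero, mul_one] at this
    have e : ∫ u in (0 : ℝ)..1, m (x * u) * ((x * u : ℝ) : ℂ) ^ s
        = (x : ℂ) ^ s * ∫ u in (0 : ℝ)..1, m (x * u) * (u : ℂ) ^ s := by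
      rw [← intervalIntegral.integral_const_mul]
      refine intervalIntegral.integral_congr (fun u hu => ?_)
      rw [uIcc_of_le zero_le_one] at hu
      rw [Complex.ofReal_mul, Complex.mul_cpow_ofReal_nonneg hx.le hu.1]
      ring
    rw [e, Complex.real_smul] at this
    have hxs : (x : ℂ) ^ s ≠ 0 := by
      rw [Complex.cpow_def_of_ne_zero hxc]; exact Complex.exp_ne_zero _
    rw [Complex.cpow_neg, Complex.cpow_add _ _ hxc, Complex.cpow_one]
    have h2 : ∫ u in (0 : ℝ)..1, m (x * u) * (u : ℂ) ^ s = ((x : ℂ) ^ s)⁻¹ *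
        ((x : ℂ) ^ s * ∫ u in (0 : ℝ)..1, m (x * u) * (u : ℂ) ^ s) := by
      rw [inv_mul_cancel_left₀ hxs]
    rw [h2, this]
    push_cast
    field_simp
  have h2 : ∫ y in Ioi (0 : ℝ), m y * (y : ℂ) ^ s = (∫ y in Ioc 0 x, m y * (y : ℂ) ^ s) +
      ∫ y in Ioi x, m y * (y : ℂ) ^ s := by
    rw [← setIntegral_union (Ioc_disjoint_Ioi le_rfl) measurableSet_Ioi
      (hi.mono_set Ioc_subset_Ioi_self) (hi.mono_set (Ioi_subset_Ioi hx.le)),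
      Ioc_union_Ioi_eq_Ioi hx.le]
  unfold mellinTail
  rw [h1, h2]
  ring

/-- The factor `1 / (1 + x)` is the gain from the cutoff. It comes from `1 + x ≤ 1 + y` inside
`∫_x^∞` and the integrability of `(1 + y) |m(y) y^s|`. -/
theorem norm_mellinTail_le (m : 𝓢(ℝ, ℂ)) {s : ℂ} (hs : 0 < s.re) :
    ∃ C : ℝ, 0 < C ∧ ∀ x, 0 < x → ‖mellinTail m s x‖ ≤ C * x ^ (-(s.re + 1)) / (1 + x) := by
  have hi0 : IntegrableOn (fun y : ℝ => ‖m y * (y : ℂ) ^ s‖) (Ioi 0) :=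
    Integrable.norm (m.integrableOn_mul_cpow (by linarith))
  have hi1 : IntegrableOn (fun y : ℝ => ‖m y * (y : ℂ) ^ (s + 1)‖) (Ioi 0) :=
    Integrable.norm (m.integrableOn_mul_cpow (by simp; linarith))
  have hi : IntegrableOn (fun y : ℝ => (1 + y) * ‖m y * (y : ℂ) ^ s‖) (Ioi 0) := by
    refine IntegrableOn.congr_fun (hi0.add hi1) (fun y hy => ?_) measurableSet_Ioi
    have hyc : (y : ℂ) ≠ 0 := by exact_mod_cast (ne_of_gt hy)
    simp only [Pi.add_apply, norm_mul]
    rw [Complex.cpow_add _ _ hyc, Complex.cpow_one, norm_mul, Complex.norm_real,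
      Real.norm_of_nonneg (le_of_lt hy)]
    ring
  have hnn : 0 ≤ ∫ y in Ioi (0 : ℝ), (1 + y) * ‖m y * (y : ℂ) ^ s‖ :=
    setIntegral_nonneg measurableSet_Ioi (fun y hy => by
      have : (0 : ℝ) < y := hy
      positivity)
  refine ⟨(∫ y in Ioi (0 : ℝ), (1 + y) * ‖m y * (y : ℂ) ^ s‖) + 1, by linarith, fun x hx => ?_⟩
  rw [mellinTail_eq m hs hx, norm_mul, Complex.norm_cpow_eq_rpow_re_of_pos hx]
  have hre : (-(s + 1)).re = -(s.re + 1) := by simp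
  rw [hre, le_div_iff₀ (by linarith), mul_comm _ (x ^ (-(s.re + 1))), mul_assoc]
  refine mul_le_mul_of_nonneg_left ?_ (by positivity)
  have h1 : ‖∫ y in Ioi x, m y * (y : ℂ) ^ s‖ * (1 + x)
      ≤ ∫ y in Ioi x, (1 + y) * ‖m y * (y : ℂ) ^ s‖ := by
    refine (mul_le_mul_of_nonneg_right (norm_integral_le_integral_norm _) (by linarith)).trans ?_
    rw [← integral_mul_const]
    refine setIntegral_mono_on ((hi0.mono_set (Ioi_subset_Ioi hx.le)).mul_const _)
      (hi.mono_set (Ioi_subset_Ioi hx.le)) measurableSet_Ioi (fun y hy => ?_)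
    rw [mul_comm]
    have : x < y := hy
    gcongr
  have h2 : ∫ y in Ioi x, (1 + y) * ‖m y * (y : ℂ) ^ s‖
      ≤ ∫ y in Ioi (0 : ℝ), (1 + y) * ‖m y * (y : ℂ) ^ s‖ := by
    refine setIntegral_mono_set hi ?_ (Ioi_subset_Ioi hx.le).eventuallyLE
    filter_upwards [self_mem_ae_restrict measurableSet_Ioi] with y hy
    have : (0 : ℝ) < y := hy
    simp only [Pi.zero_apply]
    positivity
  linarith

theorem integrableOn_mellinTail (m : 𝓢(ℝ, ℂ)) {s : ℂ} (hs : 0 < s.re) {x : ℝ} (hx : 0 < x) :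
    IntegrableOn (mellinTail m s) (Ioi x) := by
  have h1 : IntegrableOn (fun t : ℝ => (t : ℂ) ^ (-(s + 1))) (Ioi x) :=
    integrableOn_Ioi_cpow_of_lt (by simp; linarith) hx
  exact (h1.const_mul _).sub ((integrableOn_mellinHead m hs).mono_set (Ioi_subset_Ioi hx.le))

/-- The pure power contributes `κ μ^(-s) / s`, unbounded as `μ → 0`, while the head contributes at
most its `L¹` norm. For `μ ≤ μ₀` the head is at most half of the main term. -/
theorem norm_integral_mellinTail_ge (m : 𝓢(ℝ, ℂ)) {s : ℂ} (hs : 0 < s.re)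
    (hκ : ∫ y in Ioi (0 : ℝ), m y * (y : ℂ) ^ s ≠ 0) :
    ∃ c μ₀ : ℝ, 0 < c ∧ 0 < μ₀ ∧ ∀ μ, 0 < μ → μ ≤ μ₀ →
      c * μ ^ (-s.re) ≤ ‖∫ x in Ioi μ, mellinTail m s x‖ := by
  set κ := ∫ y in Ioi (0 : ℝ), m y * (y : ℂ) ^ s with hκd
  have hs0 : s ≠ 0 := by rintro rfl; simp at hs
  set E := ∫ x in Ioi (0 : ℝ), ‖mellinHead m s x‖
  have hE : 0 ≤ E := integral_nonneg fun _ => norm_nonneg _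
  set c := ‖κ‖ / (2 * ‖s‖) with hc
  have hc0 : 0 < c := by
    have := norm_pos_iff.mpr hκ
    have := norm_pos_iff.mpr hs0
    positivity
  refine ⟨c, ((E + 1) / c) ^ (-(1 / s.re)), hc0, by positivity, fun μ hμ hμ0 => ?_⟩
  have hbig : E ≤ c * μ ^ (-s.re) := by
    have h1 : (((E + 1) / c) ^ (-(1 / s.re))) ^ (-s.re) ≤ μ ^ (-s.re) :=
      Real.rpow_le_rpow_of_nonpos hμ hμ0 (by linarith)
    rw [← Real.rpow_mul (by positivity), show -(1 / s.re) * -s.re = 1 by field_simp,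
      Real.rpow_one, div_le_iff₀ hc0] at h1
    linarith
  have hi1 : IntegrableOn (fun t : ℝ => (t : ℂ) ^ (-(s + 1))) (Ioi μ) :=
    integrableOn_Ioi_cpow_of_lt (by simp; linarith) hμ
  have hi2 : IntegrableOn (mellinHead m s) (Ioi μ) :=
    (integrableOn_mellinHead m hs).mono_set (Ioi_subset_Ioi hμ.le)
  have h1 : ∫ x in Ioi μ, mellinTail m s x
      = κ * ((μ : ℂ) ^ (-s) / s) - ∫ x in Ioi μ, mellinHead m s x := by
    simp only [mellinTail]
    rw [← hκd, integral_sub (hi1.const_mul κ) hi2, integral_const_mul,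
      integral_Ioi_cpow_of_lt (by simp; linarith) hμ]
    congr 2
    rw [show -(s + 1) + 1 = -s by ring, neg_div_neg_eq]
  have h2 : ‖∫ x in Ioi μ, mellinHead m s x‖ ≤ E := by
    refine (norm_integral_le_integral_norm _).trans ?_
    refine setIntegral_mono_set (Integrable.norm (integrableOn_mellinHead m hs))
      (Filter.Eventually.of_forall fun _ => norm_nonneg _) (Ioi_subset_Ioi hμ.le).eventuallyLE
  have h3 : ‖κ * ((μ : ℂ) ^ (-s) / s)‖ = 2 * (c * μ ^ (-s.re)) := by
    rw [norm_mul, norm_div, Complex.norm_cpow_eq_rpow_re_of_pos hμ, Complex.neg_re, hc]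
    have := norm_pos_iff.mpr hs0
    field_simp
  rw [h1]
  have := norm_sub_norm_le (κ * ((μ : ℂ) ^ (-s) / s)) (∫ x in Ioi μ, mellinHead m s x)
  linarith

theorem lintegral_Ioi_one_div_mul_le {μ : ℝ} (hμ : 0 < μ) (hμ1 : μ ≤ 1) :
    ∫⁻ y in Ioi (1 : ℝ), ENNReal.ofReal (1 / (y * (1 + μ * y))) ≤
      ENNReal.ofReal (Real.log 2 + Real.log (1 / μ)) := by
  have hd : ∀ y ∈ Ici (1 : ℝ), HasDerivAt (fun y : ℝ => Real.log (y / (1 + μ * y)))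
      (1 / (y * (1 + μ * y))) y := by
    intro y hy
    have hy0 : (0 : ℝ) < y := lt_of_lt_of_le one_pos hy
    have h1 : HasDerivAt (fun y : ℝ => 1 + μ * y) (μ * 1) y :=
      ((hasDerivAt_id y).const_mul μ).const_add 1
    have h2 := ((hasDerivAt_id y).div h1 (by positivity)).log (by simp only [Pi.div_apply, id]; positivity)
    refine h2.congr_deriv ?_
    simp only [Pi.div_apply, id]
    field_simp
    ring
  have hl : Filter.Tendsto (fun y : ℝ => Real.log (y / (1 + μ * y))) Filter.atTop
      (nhds (Real.log (1 / μ))) := by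
    have h1 : Filter.Tendsto (fun y : ℝ => 1 / (y⁻¹ + μ)) Filter.atTop (nhds (1 / (0 + μ))) :=
      Filter.Tendsto.div tendsto_const_nhds (tendsto_inv_atTop_zero.add_const μ) (by linarith)
    rw [zero_add] at h1
    have h2 := h1.log (by positivity)
    refine h2.congr' ?_
    filter_upwards [Filter.eventually_gt_atTop 0] with y hy
    congr 1
    field_simp
  have hnn : ∀ y ∈ Ioi (1 : ℝ), 0 ≤ 1 / (y * (1 + μ * y)) := fun y hy => by
    have hy0 : (0 : ℝ) < y := lt_trans one_pos hy
    positivity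
  have hi := integrableOn_Ioi_deriv_of_nonneg' hd hnn hl
  have hI := integral_Ioi_of_hasDerivAt_of_nonneg' hd hnn hl
  rw [← ofReal_integral_eq_lintegral_ofReal hi
    ((ae_restrict_iff' measurableSet_Ioi).mpr (Filter.Eventually.of_forall hnn)), hI]
  apply ENNReal.ofReal_le_ofReal
  rw [mul_one, one_div (1 + μ), Real.log_inv]
  have := Real.log_le_log (by positivity : 0 < 1 + μ) (by linarith : 1 + μ ≤ 2)
  linarith

/-! ### The test function and the deterministic lower bound -/

/-- Test functions orthogonal to the dilates `fract (θ y)` for `θ ∈ [l, 1]`. -/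
theorem exists_test_function : ∃ c K : ℝ, 0 < c ∧ 0 < K ∧ ∀ l : ℝ, 0 < l → l ≤ 1 →
    ∃ G : ℝ → ℂ, IntegrableOn G (Ioi 1) ∧
      (∀ θ : ℝ, l ≤ θ → θ ≤ 1 →
        IntegrableOn (fun y => ((Int.fract (θ * y) : ℝ) : ℂ) * G y) (Ioi 0) ∧
        ∫ y in Ioi (0 : ℝ), ((Int.fract (θ * y) : ℝ) : ℂ) * G y = 0) ∧
      c ≤ ‖∫ y in Ioi (1 : ℝ), G y‖ ∧
      ENNReal.ofReal (‖∫ y in Ioc (0 : ℝ) 1, (y : ℂ) * G y‖ ^ 2) +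
        ∫⁻ y in Ioi (1 : ℝ), ENNReal.ofReal (‖(y : ℂ) * G y‖ ^ 2) ≤
        ENNReal.ofReal (K * (Real.log 2 + Real.log (1 / l))) := by
  obtain ⟨s, hs2, hs1, hz⟩ := exists_riemannZeta_zero
  have hs : 0 < s.re := by linarith
  obtain ⟨m, B, hB, hm, hκ⟩ := exists_kernel hs
  obtain ⟨C, hC, hD⟩ := norm_mellinTail_le m hs
  obtain ⟨c, μ₀, hc, hμ₀, hlow⟩ := norm_integral_mellinTail_ge m hs hκ
  set a := s.re with ha
  obtain ⟨b, hb1, hbB, hbμ⟩ : ∃ b : ℝ, 1 ≤ b ∧ B ≤ b ∧ 1 / μ₀ ≤ b :=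
    ⟨max 1 (max B (1 / μ₀)), le_max_left _ _, (le_max_left _ _).trans (le_max_right _ _),
      (le_max_right _ _).trans (le_max_right _ _)⟩
  have hlog2 : 0 < Real.log 2 := Real.log_pos one_lt_two
  have hlogb : 0 ≤ Real.log b := Real.log_nonneg hb1
  have ha1 : 0 < 1 - a := by linarith
  refine ⟨c, C ^ 2 * (1 / ((1 - a) ^ 2 * Real.log 2) + Real.log b / Real.log 2 + 1), hc,
    by positivity, fun l hl hl1 => ?_⟩
  have hb0 : 0 < b := by linarith
  -- The cutoff sits at height `1 / μ`, comparable to `1 / l`. Here `b ≥ B` ensures `θ / μ ≥ B` for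
  -- all `θ ≥ l`, and `b ≥ 1 / μ₀` ensures `μ ≤ μ₀`. The normalization `r` makes `y G(y)` of size at
  -- most `C y^(-a) / (1 + μ y)`.
  set μ := l / b with hμd
  have hμ : 0 < μ := by positivity
  have hμ1 : μ ≤ 1 := by rw [hμd, div_le_one hb0]; linarith
  have hμμ : μ ≤ μ₀ := by
    rw [hμd, div_le_iff₀ hb0]
    rw [div_le_iff₀ hμ₀] at hbμ
    linarith
  set r : ℂ := ((μ ^ a * μ : ℝ) : ℂ) with hr
  have hrn : ‖r‖ = μ ^ a * μ := by rw [hr, Complex.norm_real, Real.norm_of_nonneg (by positivity)]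
  have hG : ∀ y : ℝ, 0 < y → ‖(y : ℂ) * (r * mellinTail m s (μ * y))‖
      ≤ C * y ^ (-a) / (1 + μ * y) := by
    intro y hy
    have h := hD (μ * y) (by positivity)
    rw [norm_mul, norm_mul, hrn, Complex.norm_real, Real.norm_of_nonneg hy.le]
    calc y * (μ ^ a * μ * ‖mellinTail m s (μ * y)‖)
        ≤ y * (μ ^ a * μ * (C * (μ * y) ^ (-(a + 1)) / (1 + μ * y))) := by gcongr
      _ = C * y ^ (-a) / (1 + μ * y) := by
          rw [Real.mul_rpow hμ.le hy.le, neg_add, Real.rpow_add hμ, Real.rpow_add hy,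
            Real.rpow_neg hμ.le, Real.rpow_neg_one, Real.rpow_neg_one]
          have : μ ^ a ≠ 0 := by positivity
          field_simp
  refine ⟨fun y => r * mellinTail m s (μ * y), ?_, fun θ hθ hθ1 => ?_, ?_, ?_⟩
  · have h := (integrableOn_Ioi_comp_mul_left_iff (mellinTail m s) 1 hμ).mpr
      (integrableOn_mellinTail m hs (by positivity))
    exact h.const_mul r
  · have hT : B ≤ θ / μ := by
      rw [le_div_iff₀ hμ]
      calc B * μ ≤ b * μ := by gcongr
        _ = l := by rw [hμd]; field_simp
        _ ≤ θ := hθ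
    obtain ⟨h1, h2⟩ := integral_fract_mul_mellinTail_eq_zero m hs hs1 hz hB hT hm
    have e : ∀ y : ℝ, ((Int.fract (θ * y) : ℝ) : ℂ) * (r * mellinTail m s (μ * y))
        = r * (((Int.fract (θ / μ * (μ * y)) : ℝ) : ℂ) * mellinTail m s (μ * y)) := by
      intro y
      rw [show θ / μ * (μ * y) = θ * y by field_simp]
      ring
    have h3 := (integrableOn_Ioi_comp_mul_left_iff
      (fun x => ((Int.fract (θ / μ * x) : ℝ) : ℂ) * mellinTail m s x) 0 hμ).mpr
      (by rwa [mul_zero])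
    have h4 := integral_comp_mul_left_Ioi
      (fun x => ((Int.fract (θ / μ * x) : ℝ) : ℂ) * mellinTail m s x) 0 hμ
    rw [mul_zero, h2, smul_zero] at h4
    simp only [e]
    exact ⟨h3.const_mul r, by rw [integral_const_mul, h4, mul_zero]⟩
  · have h := hlow μ hμ hμμ
    rw [integral_const_mul, integral_comp_mul_left_Ioi (mellinTail m s) 1 hμ, mul_one,
      norm_mul, norm_smul, hrn, Real.norm_of_nonneg (by positivity)]
    have h2 : μ ^ a * μ * (μ⁻¹ * (c * μ ^ (-a))) = c := by
      rw [Real.rpow_neg hμ.le]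
      have : μ ^ a ≠ 0 := by positivity
      field_simp
    calc c = μ ^ a * μ * (μ⁻¹ * (c * μ ^ (-a))) := h2.symm
      _ ≤ _ := by gcongr
  -- Near `0` only the integral of `y G` is controlled, using `a < 1`; the majorant `y^(-a)` is not
  -- square integrable there because `a ≥ 1/2`.
  · have h1 : ‖∫ y in Ioc (0 : ℝ) 1, (y : ℂ) * (r * mellinTail m s (μ * y))‖ ≤ C / (1 - a) := by
      have hp : ∫ y in Ioc (0 : ℝ) 1, C * y ^ (-a) = C / (1 - a) := by
        rw [integral_const_mul, ← intervalIntegral.integral_of_le zero_le_one,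
          integral_rpow (Or.inl (by linarith)), Real.one_rpow, Real.zero_rpow (by linarith)]
        ring
      rw [← hp]
      refine norm_integral_le_of_norm_le (((intervalIntegrable_iff_integrableOn_Ioc_of_le
        zero_le_one).mp (intervalIntegral.intervalIntegrable_rpow' (by linarith))).const_mul C) ?_
      filter_upwards [self_mem_ae_restrict measurableSet_Ioc] with y hy
      have hy0 : 0 < y := hy.1
      refine (hG y hy0).trans (div_le_self (by positivity) ?_)
      have : 0 < μ * y := by positivity
      linarith
    have h2 : ∫⁻ y in Ioi (1 : ℝ), ENNReal.ofReal (‖(y : ℂ) * (r * mellinTail m s (μ * y))‖ ^ 2)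
        ≤ ENNReal.ofReal (C ^ 2 * (Real.log 2 + Real.log (1 / μ))) := by
      rw [ENNReal.ofReal_mul (by positivity)]
      refine le_trans ?_ (mul_le_mul_right (lintegral_Ioi_one_div_mul_le hμ hμ1) _)
      rw [← lintegral_const_mul' _ _ ENNReal.ofReal_ne_top]
      refine setLIntegral_mono' measurableSet_Ioi (fun y hy => ?_)
      have hy1 : (1 : ℝ) < y := hy
      have hy0 : (0 : ℝ) < y := by linarith
      rw [← ENNReal.ofReal_mul (by positivity)]
      apply ENNReal.ofReal_le_ofReal
      have hμy : 0 < μ * y := by positivity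
      calc ‖(y : ℂ) * (r * mellinTail m s (μ * y))‖ ^ 2
          ≤ (C * y ^ (-a) / (1 + μ * y)) ^ 2 := by gcongr; exact hG y hy0
        _ = C ^ 2 * ((y ^ (-a) * y ^ (-a)) * (1 / (1 + μ * y)) * (1 / (1 + μ * y))) := by ring
        -- This is where `a ≥ 1/2` enters: `y^(-2a) ≤ y⁻¹` for `y ≥ 1`. One factor `1 / (1 + μ y)`
        -- is enough for convergence.
        _ ≤ C ^ 2 * (y ^ (-1 : ℝ) * (1 / (1 + μ * y)) * 1) := by
            gcongr
            · rw [← Real.rpow_add hy0]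
              exact Real.rpow_le_rpow_of_exponent_le hy1.le (by linarith)
            · rw [div_le_one (by positivity)]; linarith
        _ = C ^ 2 * (1 / (y * (1 + μ * y))) := by
            rw [Real.rpow_neg_one]
            field_simp
    have hll : 0 ≤ Real.log (1 / l) := Real.log_nonneg (by rw [le_div_iff₀ hl]; linarith)
    have hlogμ : Real.log (1 / μ) = Real.log b + Real.log (1 / l) := by
      rw [← Real.log_mul hb0.ne' (by positivity), hμd]
      congr 1
      field_simp
    refine (add_le_add (ENNReal.ofReal_le_ofReal (pow_le_pow_left₀ (norm_nonneg _) h1 2))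
      h2).trans ?_
    rw [← ENNReal.ofReal_add (by positivity) (by rw [hlogμ]; positivity)]
    apply ENNReal.ofReal_le_ofReal
    rw [hlogμ]
    have e : C ^ 2 * (1 / ((1 - a) ^ 2 * Real.log 2) + Real.log b / Real.log 2 + 1) *
        (Real.log 2 + Real.log (1 / l)) = (C / (1 - a)) ^ 2 +
        C ^ 2 * (Real.log 2 + (Real.log b + Real.log (1 / l))) +
        C ^ 2 * (1 / ((1 - a) ^ 2 * Real.log 2) + Real.log b / Real.log 2) *
          Real.log (1 / l) := by
      field_simp
      ring
    rw [e]
    have : 0 ≤ C ^ 2 * (1 / ((1 - a) ^ 2 * Real.log 2) + Real.log b / Real.log 2) *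
          Real.log (1 / l) := by positivity
    linarith

end

theorem ofReal_norm_integral_sq_le {α : Type*} [MeasurableSpace α] {μ : Measure α} {f : α → ℝ}
    {g : α → ℂ} (hf : AEMeasurable f μ) (hg : AEMeasurable g μ) :
    ENNReal.ofReal (‖∫ x, (f x : ℂ) * g x ∂μ‖ ^ 2) ≤
      (∫⁻ x, ENNReal.ofReal (f x ^ 2) ∂μ) * ∫⁻ x, ENNReal.ofReal (‖g x‖ ^ 2) ∂μ := by
  have h1 : ENNReal.ofReal ‖∫ x, (f x : ℂ) * g x ∂μ‖ ≤ ∫⁻ x, ‖f x‖ₑ * ‖g x‖ₑ ∂μ := by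
    rw [ofReal_norm]
    refine (enorm_integral_le_lintegral_enorm _).trans_eq ?_
    refine lintegral_congr fun x => ?_
    rw [enorm_mul]
    congr 1
    rw [← ofReal_norm, ← ofReal_norm, Complex.norm_real]
  have h2 := ENNReal.lintegral_mul_le_Lp_mul_Lq μ Real.HolderConjugate.two_two hf.enorm hg.enorm
  have e : ∀ z : ℝ≥0∞, (z ^ (1 / 2 : ℝ)) ^ 2 = z := fun z => by
    rw [← ENNReal.rpow_natCast, ← ENNReal.rpow_mul]; norm_num
  have ef : ∀ x, ‖f x‖ₑ ^ (2 : ℝ) = ENNReal.ofReal (f x ^ 2) := fun x => by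
    rw [← ofReal_norm, ENNReal.rpow_two, ← ENNReal.ofReal_pow (norm_nonneg _),
      Real.norm_eq_abs, sq_abs]
  have eg : ∀ x, ‖g x‖ₑ ^ (2 : ℝ) = ENNReal.ofReal (‖g x‖ ^ 2) := fun x => by
    rw [← ofReal_norm, ENNReal.rpow_two, ← ENNReal.ofReal_pow (norm_nonneg _)]
  simp only [ef, eg] at h2
  rw [ENNReal.ofReal_pow (norm_nonneg _)]
  refine (pow_le_pow_left₀ zero_le (h1.trans h2) 2).trans_eq ?_
  rw [mul_pow, e, e]

/-- Cauchy–Schwarz against the test function gives `C = b² / K`, from its lower bound `b` and its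
norm bound `K (log 2 + log (1 / l))`. -/
theorem exists_le_lintegral_sub_sum_fract : ∃ C : ℝ, 0 < C ∧ ∀ (n : ℕ) (θ c : Fin n → ℝ) (l : ℝ),
    0 < l → l ≤ 1 → (∀ k, l ≤ θ k ∧ θ k ≤ 1) →
    ENNReal.ofReal (C / (Real.log 2 + Real.log (1 / l))) ≤
      ∫⁻ y in Ioi (0 : ℝ), ENNReal.ofReal
        ((((Ici (1 : ℝ)).indicator 1 y - ∑ k, c k * Int.fract (θ k * y)) / y) ^ 2) := by
  obtain ⟨b, K, hb, hK, H⟩ := exists_test_function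
  refine ⟨b ^ 2 / K, by positivity, fun n θ c l hl hl1 hθ => ?_⟩
  obtain ⟨G, hG1, hGθ, hlow, hup⟩ := H l hl hl1
  set p : ℝ → ℝ := fun y => (Ici (1 : ℝ)).indicator 1 y - ∑ k, c k * Int.fract (θ k * y) with hp
  set S : ℝ := ∑ k, c k * θ k with hS
  set A : ℂ := ∫ y in Ioc (0 : ℝ) 1, (y : ℂ) * G y with hA
  have hlog2 : 0 < Real.log 2 := Real.log_pos one_lt_two
  have hll : 0 ≤ Real.log (1 / l) := Real.log_nonneg (by rw [le_div_iff₀ hl]; linarith)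
  have hpm : Measurable p := by
    refine (measurable_one.indicator measurableSet_Ici).sub ?_
    exact Finset.measurable_sum _ fun k _ =>
      (measurable_fract.comp (measurable_const_mul _)).const_mul _
  have hsub : ∀ y : ℝ, y ∈ Ioo (0 : ℝ) 1 → p y = -(S * y) := by
    intro y hy
    simp only [hp]
    rw [indicator_of_notMem (by simpa using hy.2), zero_sub, hS, Finset.sum_mul]
    congr 1
    refine Finset.sum_congr rfl fun k _ => ?_
    rw [Int.fract_eq_self.mpr, mul_assoc]
    have h0 : 0 < θ k := hl.trans_le (hθ k).1
    refine ⟨by have := hy.1; positivity, ?_⟩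
    calc θ k * y < θ k * 1 := by gcongr; exact hy.2
      _ ≤ 1 := by linarith [(hθ k).2]
  have hae : ∀ᵐ y ∂(volume.restrict (Ioc (0 : ℝ) 1)), y ∈ Ioo (0 : ℝ) 1 := by
    rw [restrict_Ioo_eq_restrict_Ioc.symm]
    exact self_mem_ae_restrict measurableSet_Ioo
  have hyG : IntegrableOn (fun y : ℝ => (y : ℂ) * G y) (Ioc 0 1) := by
    refine ((hGθ 1 hl1 le_rfl).1.mono_set Ioc_subset_Ioi_self).congr ?_
    filter_upwards [hae] with y hy
    rw [one_mul, Int.fract_eq_self.mpr ⟨hy.1.le, hy.2⟩]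
  have hfr : ∀ k, ∫ y in Ioi (1 : ℝ), ((Int.fract (θ k * y) : ℝ) : ℂ) * G y = -(θ k * A) := by
    intro k
    obtain ⟨h1, h2⟩ := hGθ (θ k) (hθ k).1 (hθ k).2
    rw [← Ioc_union_Ioi_eq_Ioi zero_le_one, setIntegral_union (Ioc_disjoint_Ioi le_rfl)
      measurableSet_Ioi (h1.mono_set Ioc_subset_Ioi_self)
      (h1.mono_set (Ioi_subset_Ioi zero_le_one))] at h2
    have h3 : ∫ y in Ioc (0 : ℝ) 1, ((Int.fract (θ k * y) : ℝ) : ℂ) * G y = θ k * A := by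
      rw [hA, ← integral_const_mul]
      refine integral_congr_ae ?_
      filter_upwards [hae] with y hy
      have h0 : 0 < θ k := hl.trans_le (hθ k).1
      rw [Int.fract_eq_self.mpr ⟨by have := hy.1; positivity, ?_⟩]
      · push_cast; ring
      · calc θ k * y < θ k * 1 := by gcongr; exact hy.2
          _ ≤ 1 := by linarith [(hθ k).2]
    rw [h3] at h2
    linear_combination h2
  have hpG : ∀ y ∈ Ioi (1 : ℝ), (p y : ℂ) * G y
      = G y - ∑ k, (c k : ℂ) * (((Int.fract (θ k * y) : ℝ) : ℂ) * G y) := by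
    intro y hy
    have hy1 : y ∈ Ici (1 : ℝ) := mem_Ici.mpr (le_of_lt hy)
    simp only [hp, indicator_of_mem hy1, Pi.one_apply]
    push_cast
    rw [sub_mul, one_mul, Finset.sum_mul]
    simp only [mul_assoc]
  have hisum : ∀ k ∈ Finset.univ, IntegrableOn (fun y : ℝ =>
      (c k : ℂ) * (((Int.fract (θ k * y) : ℝ) : ℂ) * G y)) (Ioi 1) := fun k _ =>
    (integrableOn_fract_mul hG1 (θ k)).const_mul _
  have hipG : IntegrableOn (fun y => (p y : ℂ) * G y) (Ioi 1) :=
    IntegrableOn.congr_fun (Integrable.sub hG1 (integrable_finsetSum _ hisum))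
      (fun y hy => (hpG y hy).symm) measurableSet_Ioi
  have hIpG : ∫ y in Ioi (1 : ℝ), (p y : ℂ) * G y = (∫ y in Ioi (1 : ℝ), G y) + S * A := by
    rw [setIntegral_congr_fun measurableSet_Ioi hpG,
      integral_sub hG1 (integrable_finsetSum _ hisum), integral_finsetSum _ hisum]
    simp only [integral_const_mul, hfr]
    rw [hS]
    push_cast
    rw [Finset.sum_mul, sub_eq_add_neg, ← Finset.sum_neg_distrib]
    congr 1
    refine Finset.sum_congr rfl fun k _ => ?_
    ring
  -- On `(0, 1)` the function `p y / y` is the constant `-S`, so `y G(y)` may be replaced there by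
  -- its mean `A`. This makes the dual function square integrable near `0` without changing the
  -- pairing.
  set W : ℝ → ℂ := fun y => if y ≤ 1 then A else (y : ℂ) * G y with hW
  have hW0 : ∀ᵐ y ∂(volume.restrict (Ioc (0 : ℝ) 1)),
      ((p y / y : ℝ) : ℂ) * W y = -(S * A) := by
    filter_upwards [hae] with y hy
    have hy0 : y ≠ 0 := hy.1.ne'
    simp only [hW]
    rw [if_pos hy.2.le, hsub y hy, show -(S * y) / y = -S by field_simp]
    push_cast
    ring
  have hW1 : ∀ y ∈ Ioi (1 : ℝ), ((p y / y : ℝ) : ℂ) * W y = (p y : ℂ) * G y := by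
    intro y hy
    have hy1 : (1 : ℝ) < y := hy
    have hy0 : (y : ℂ) ≠ 0 := by exact_mod_cast (by linarith : (0 : ℝ) < y).ne'
    simp only [hW]
    rw [if_neg (not_le.mpr hy1)]
    push_cast
    field_simp
  -- The contribution `-S A` of `(0, 1]` cancels the `S A` that orthogonality produces on `(1, ∞)`.
  have hV : ∫ y in Ioi (0 : ℝ), ((p y / y : ℝ) : ℂ) * W y = ∫ y in Ioi (1 : ℝ), G y := by
    rw [← Ioc_union_Ioi_eq_Ioi (zero_le_one' ℝ), setIntegral_union (Ioc_disjoint_Ioi le_rfl)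
      measurableSet_Ioi ((integrable_const (-(S * A))).congr (hW0.mono fun _ h => h.symm))
      (hipG.congr_fun (fun y hy => (hW1 y hy).symm) measurableSet_Ioi),
      integral_congr_ae hW0, setIntegral_congr_fun measurableSet_Ioi hW1, hIpG]
    simp
  have hWm : AEMeasurable W (volume.restrict (Ioi 0)) := by
    rw [← Ioc_union_Ioi_eq_Ioi (zero_le_one' ℝ), aemeasurable_union_iff]
    constructor
    · refine (aemeasurable_const (b := A)).congr ?_
      filter_upwards [hae] with y hy
      simp only [hW, if_pos hy.2.le]
    · refine (Complex.measurable_ofReal.aemeasurable.mul hG1.aemeasurable).congr ?_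
      filter_upwards [self_mem_ae_restrict measurableSet_Ioi] with y hy
      simp only [hW, if_neg (not_le.mpr (mem_Ioi.mp hy)), Pi.mul_apply]
  have hWn : ∫⁻ y in Ioi (0 : ℝ), ENNReal.ofReal (‖W y‖ ^ 2)
      ≤ ENNReal.ofReal (K * (Real.log 2 + Real.log (1 / l))) := by
    refine le_of_eq_of_le ?_ hup
    rw [← Ioc_union_Ioi_eq_Ioi (zero_le_one' ℝ), lintegral_union measurableSet_Ioi
      (Ioc_disjoint_Ioi le_rfl)]
    congr 1
    · rw [setLIntegral_congr_fun (g := fun _ => ENNReal.ofReal (‖A‖ ^ 2)) measurableSet_Ioc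
        (fun y hy => by simp only [hW, if_pos hy.2])]
      simp
    · exact setLIntegral_congr_fun measurableSet_Ioi
        (fun y hy => by simp only [hW, if_neg (not_le.mpr (mem_Ioi.mp hy))])
  have hcs := ofReal_norm_integral_sq_le (f := fun y => p y / y)
    (μ := volume.restrict (Ioi 0)) (hpm.div measurable_id).aemeasurable hWm
  rw [hV] at hcs
  have hX : 0 < K * (Real.log 2 + Real.log (1 / l)) := by positivity
  rw [div_div, ENNReal.ofReal_div_of_pos hX]
  refine ENNReal.div_le_of_le_mul ?_
  calc ENNReal.ofReal (b ^ 2) ≤ ENNReal.ofReal (‖∫ y in Ioi (1 : ℝ), G y‖ ^ 2) := by gcongr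
    _ ≤ _ := hcs
    _ ≤ _ := by gcongr

theorem exists_le_lintegral_chi_sub_sum_fract : ∃ C : ℝ, 0 < C ∧
    ∀ (n : ℕ) (θ c : Fin n → ℝ) (l : ℝ), 0 < l → l ≤ 1 → (∀ k, l ≤ θ k ∧ θ k ≤ 1) →
    ENNReal.ofReal (C / (Real.log 2 + Real.log (1 / l))) ≤
      ∫⁻ t in Ioi (0 : ℝ), ENNReal.ofReal
        ((PNB.chi t - ∑ k, c k * Int.fract (θ k / t)) ^ 2) := by
  obtain ⟨C, hC, H⟩ := exists_le_lintegral_sub_sum_fract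
  refine ⟨C, hC, fun n θ c l hl hl1 hθ => (H n θ c l hl hl1 hθ).trans_eq ?_⟩
  have himg : (fun y : ℝ => y⁻¹) '' Ioi 0 = Ioi 0 := by
    ext t
    simp only [mem_image, mem_Ioi]
    exact ⟨fun ⟨y, hy, h⟩ => h ▸ inv_pos.mpr hy, fun h => ⟨t⁻¹, inv_pos.mpr h, inv_inv t⟩⟩
  have h := lintegral_image_eq_lintegral_abs_deriv_mul (s := Ioi (0 : ℝ))
    (f := fun y : ℝ => y⁻¹) (f' := fun y => -(y ^ 2)⁻¹) measurableSet_Ioi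
    (fun y hy => (hasDerivAt_inv (ne_of_gt (mem_Ioi.mp hy))).hasDerivWithinAt)
    inv_injective.injOn (fun t => ENNReal.ofReal
        ((PNB.chi t - ∑ k, c k * Int.fract (θ k / t)) ^ 2))
  rw [himg] at h
  rw [h]
  refine setLIntegral_congr_fun measurableSet_Ioi (fun y hy => ?_)
  have hy0 : 0 < y := hy
  rw [← ENNReal.ofReal_mul (abs_nonneg _)]
  congr 1
  have hchi : PNB.chi y⁻¹ = (Ici (1 : ℝ)).indicator 1 y := by
    unfold PNB.chi
    have h1 : y⁻¹ ∈ Ioc (0 : ℝ) 1 ↔ y ∈ Ici (1 : ℝ) := by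
      rw [mem_Ioc, mem_Ici, inv_le_one₀ hy0]
      exact and_iff_right (inv_pos.mpr hy0)
    by_cases h2 : y ∈ Ici (1 : ℝ)
    · rw [indicator_of_mem h2, indicator_of_mem (h1.mpr h2)]
      rfl
    · rw [indicator_of_notMem h2, indicator_of_notMem (fun h => h2 (h1.mp h))]
  -- The Jacobian `y⁻²` of `t = 1 / y` becomes the division by `y` inside the square.
  rw [hchi, abs_neg, abs_of_pos (by positivity), div_pow, div_eq_inv_mul]
  simp only [div_inv_eq_mul]

/-! ### Averaging over the probability space -/

theorem sq_measure_le_lintegral_mul_lintegral_inv {α : Type*} [MeasurableSpace α] {μ : Measure α}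
    {f : α → ℝ} (hf : AEMeasurable f μ) (hpos : ∀ᵐ x ∂μ, 0 < f x) :
    μ univ ^ 2 ≤ (∫⁻ x, ENNReal.ofReal (f x) ∂μ) * ∫⁻ x, ENNReal.ofReal (1 / f x) ∂μ := by
  have h := ENNReal.lintegral_mul_le_Lp_mul_Lq μ Real.HolderConjugate.two_two
    (f := fun x => ENNReal.ofReal (f x) ^ (1 / 2 : ℝ))
    (g := fun x => ENNReal.ofReal (1 / f x) ^ (1 / 2 : ℝ))
    (hf.ennreal_ofReal.pow_const _) ((hf.const_div 1).ennreal_ofReal.pow_const _)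
  have e1 : ∀ z : ℝ≥0∞, (z ^ (1 / 2 : ℝ)) ^ (2 : ℝ) = z := fun z => by
    rw [← ENNReal.rpow_mul]; norm_num
  have e2 : ∫⁻ x, ((fun x => ENNReal.ofReal (f x) ^ (1 / 2 : ℝ)) *
      fun x => ENNReal.ofReal (1 / f x) ^ (1 / 2 : ℝ)) x ∂μ = μ univ := by
    rw [← lintegral_one]
    refine lintegral_congr_ae ?_
    filter_upwards [hpos] with x hx
    rw [Pi.mul_apply, ← ENNReal.mul_rpow_of_nonneg _ _ (by norm_num),
      ← ENNReal.ofReal_mul hx.le, mul_one_div_cancel hx.ne', ENNReal.ofReal_one,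
      ENNReal.one_rpow]
  rw [e2] at h
  simp only [e1] at h
  refine (pow_le_pow_left₀ zero_le h 2).trans_eq ?_
  rw [mul_pow, ← ENNReal.rpow_two, ← ENNReal.rpow_two, e1, e1]

theorem absLog_of_pos {x : ℝ} (hx : 0 < x) : PNB.absLog x = ENNReal.ofReal |Real.log x| := by
  rw [PNB.absLog, ENNReal.log_ofReal, if_neg (not_le.mpr hx), EReal.abs_def]

theorem mainTheorem5 (ν : ℝ) (hν : 0 < ν) :
    ∃ C : ℝ, 0 < C ∧
      ∀ (Ω : Type u) [MeasurableSpace Ω] (P : Measure Ω) [IsProbabilityMeasure P]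
        (Z : (n : ℕ) → Fin n → Ω → ℝ),
        (∀ (n : ℕ) (k : Fin n), PNB.MemL2Plus P (Z n k)) →
        PNB.AssumptionP P Z ν →
        ∀ n : ℕ, 1 ≤ n →
          ENNReal.ofReal C / (ENNReal.ofReal (Real.log 2) + ∫⁻ ω, PNB.absLog (PNB.minZ Z n ω) ∂P)
            ≤ PNB.pNBDist P Z n ^ 2 := by
  obtain ⟨C, hC, H⟩ := exists_le_lintegral_chi_sub_sum_fract
  refine ⟨C * ν ^ 2, by positivity, fun Ω _ P _ Z hZ hP n hn => ?_⟩
  have hlog2 : 0 < Real.log 2 := Real.log_pos one_lt_two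
  have : Nonempty (Fin n) := ⟨⟨0, hn⟩⟩
  set B : Set Ω := ⋂ k : Fin n, {ω | 0 < Z n k ω ∧ Z n k ω ≤ 1} with hB
  have hZm : ∀ k, AEMeasurable (Z n k) P := fun k => (hZ n k).1.aestronglyMeasurable.aemeasurable
  have hBm : NullMeasurableSet B P := NullMeasurableSet.iInter fun k =>
    (hZm k).nullMeasurableSet_preimage (measurableSet_Ioc (a := (0 : ℝ)) (b := 1))
  have hm : AEMeasurable (PNB.minZ Z n) P := AEMeasurable.iInf hZm
  have hmB : ∀ ω ∈ B, 0 < PNB.minZ Z n ω ∧ PNB.minZ Z n ω ≤ 1 ∧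
      ∀ k, PNB.minZ Z n ω ≤ Z n k ω ∧ Z n k ω ≤ 1 := by
    intro ω hω
    have hω' := mem_iInter.mp hω
    obtain ⟨i, hi⟩ := exists_eq_ciInf_of_finite (f := fun k => Z n k ω)
    have hi' : Z n i ω = PNB.minZ Z n ω := hi
    exact ⟨hi' ▸ (hω' i).1, hi' ▸ (hω' i).2,
      fun k => ⟨ciInf_le (Finite.bddBelow_range _) k, (hω' k).2⟩⟩
  set X : Ω → ℝ := fun ω => Real.log 2 + |Real.log (PNB.minZ Z n ω)| with hX
  have hX0 : ∀ ω, 0 < X ω := fun ω => by positivity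
  have hXm : AEMeasurable X P := by
    have h1 := (Real.measurable_log.comp_aemeasurable hm).norm
    exact h1.const_add _
  set J := ∫⁻ ω in B, ENNReal.ofReal (1 / X ω) ∂P with hJ
  set D := ENNReal.ofReal (Real.log 2) + ∫⁻ ω, PNB.absLog (PNB.minZ Z n ω) ∂P with hD
  have hXD : ∫⁻ ω in B, ENNReal.ofReal (X ω) ∂P ≤ D := by
    calc ∫⁻ ω in B, ENNReal.ofReal (X ω) ∂P
        ≤ ∫⁻ ω in B, (ENNReal.ofReal (Real.log 2) + PNB.absLog (PNB.minZ Z n ω)) ∂P := by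
          refine lintegral_mono_ae ?_
          filter_upwards [ae_restrict_mem₀ hBm] with ω hω
          rw [absLog_of_pos (hmB ω hω).1, ← ENNReal.ofReal_add hlog2.le (abs_nonneg _)]
      _ ≤ ∫⁻ ω, (ENNReal.ofReal (Real.log 2) + PNB.absLog (PNB.minZ Z n ω)) ∂P :=
          setLIntegral_le_lintegral _ _
      _ = D := by rw [lintegral_add_left measurable_const]; simp [hD]
  -- Cauchy–Schwarz on `B` for `√X · (1 / √X) = 1`. The estimate remains meaningful when `D = ∞`,
  -- where the final lower bound is zero.
  have hνJ : ENNReal.ofReal (ν ^ 2) ≤ D * J := by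
    have h := sq_measure_le_lintegral_mul_lintegral_inv hXm.restrict
      (Filter.Eventually.of_forall hX0 : ∀ᵐ ω ∂(P.restrict B), 0 < X ω)
    rw [Measure.restrict_apply_univ] at h
    rw [ENNReal.ofReal_pow hν.le]
    exact (pow_le_pow_left₀ zero_le (hP.2 n hn).le 2).trans (h.trans (by gcongr))
  have hlow : ENNReal.ofReal (C * ν ^ 2) / D ≤ ENNReal.ofReal C * J := by
    refine ENNReal.div_le_of_le_mul ?_
    rw [ENNReal.ofReal_mul hC.le, mul_assoc, mul_comm J]
    gcongr
  have hnorm : ∀ c : Fin n → ℝ, ENNReal.ofReal C * J ≤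
      ∫⁻ ω, (∫⁻ t in Ioi (0 : ℝ), ENNReal.ofReal
        ((PNB.chi t - ∑ k : Fin n, c k * Int.fract (Z n k ω / t)) ^ 2)) ∂P := by
    intro c
    refine le_trans ?_ (setLIntegral_le_lintegral B _)
    rw [hJ, ← lintegral_const_mul' _ _ ENNReal.ofReal_ne_top]
    refine lintegral_mono_ae ?_
    filter_upwards [ae_restrict_mem₀ hBm] with ω hω
    obtain ⟨h0, h1, h2⟩ := hmB ω hω
    refine le_of_eq_of_le ?_ (H n (fun k => Z n k ω) c (PNB.minZ Z n ω) h0 h1 h2)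
    -- On `B` the minimum lies in `(0, 1]`, so `|log mₙ| = log (1 / mₙ)` and the deterministic bound
    -- with `l = mₙ(ω)` is exactly `C / X ω`.
    rw [← ENNReal.ofReal_mul hC.le, mul_one_div]
    simp only [hX]
    rw [abs_of_nonpos (Real.log_nonpos h0.le h1), one_div, Real.log_inv]
  have hdist : (ENNReal.ofReal C * J) ^ (1 / 2 : ℝ) ≤ PNB.pNBDist P Z n :=
    le_iInf fun c => ENNReal.rpow_le_rpow (hnorm c) (by norm_num)
  refine hlow.trans (le_of_eq_of_le ?_ (pow_le_pow_left₀ zero_le hdist 2))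
  rw [← ENNReal.rpow_two, ← ENNReal.rpow_mul]
  norm_num
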